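/- **Conventions.** Let $I_1,I_2,I_3,R\ge 1$. For real tensors $\mathcal A\in\mathbb R^{I_1\times J\times I_3}$, $\mathcal B\in\mathbb R^{J\times I_2\times I_3}$ the t-product $\mathcal A*\mathcal B$ has the tubes $(\mathcal A*\mathcal B)(i,j,:)=\sum_{s}\mathcal A(i,s,:)\bullet\mathcal B(s,j,:)$, with $\bullet$ the circular convolution; $\mathcal A^\top$ is obtained by transposing all frontal slices and reversing the order of the slices $2,\dots,I_3$; the identity tensor has first frontal slice $I$ and all others $0$, inverses are taken with respect to $*$, and $\mathrm{GL}(R)$ is the set of invertible tensors in $\mathbb R^{R\times R\times I_3}$. $\widehat{\mathcal A}$ is the discrete Fourier transform along the third mode, with frontal slices $\widehat{\mathbf A}^{(l)}$. The tubal rank is $\max_l\operatorname{rank}\widehat{\mathbf A}^{(l)}$, and $\sigma_{\min}(\mathcal A)$ is the smallest nonzero singular value of all the $\widehat{\mathbf A}^{(l)}$. $\|\cdot\|_{\mathrm F}$ and $\|\cdot\|_\infty$ are the entrywise $\ell_2$ and maximum norms, $\|\mathcal A\|_{2,\infty}=\max_{i}\|\mathcal A(i,:,:)\|_{\mathrm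 F}$, and $[\mathrm T_\zeta(\mathcal A)]_{ijl}=\operatorname{sign}(a_{ijl})\max(0,|a_{ijl}|-\zeta)$. **Setting.** Let $\mathcal X_\star\in\mathbb R^{I_1\times I_2\times I_3}$ have tubal rank $R$, with all the matrices $\widehat{\mathbf X}_\star^{(l)}$ of rank exactly $R$, and let $\mathcal X_\star=\mathcal U_\star*\mathit\Sigma_\star*\mathcal V_\star^\top$ be a skinny t-SVD: $\mathcal U_\star^\top*\mathcal U_\star=\mathcal V_\star^\top*\mathcal V_\star=\mathcal I$, and the frontal slices of $\mathit\Sigma_\star\in\mathbb R^{R\times R\times I_3}$ are diagonal, with real nonnegative diagonals in the Fourier domain. Let $\mathit\Sigma_\star^{1/2}$ be the tensor obtained by taking square roots of these diagonals in the Fourier domain, $\mathcal L_\star=\mathcal U_\star*\mathit\Sigma_\star^{1/2}$ and $\mathcal R_\star=\mathcal V_\star*\mathit\Sigma_\star^{1/2}$. Assume that for some $\mu\ge1$ $$\|\mathcal U_\star\|_{2,\infty}\le\sqrt{\mu R/I_1},\qquad \|\mathcal V_\star\|_{2,\infty}\le\sqrt{\mu R/I_2}.$$ Let at most a fraction $\alpha$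 of the entries of each horizontal, lateral and frontal slice of $\mathcal S_\star\in\mathbb R^{I_1\times I_2\times I_3}$ be nonzero, where $\alpha\le\frac{1}{10^4\mu R^{1.5}I_3^{1.5}}$, and let $\mathcal Y=\mathcal X_\star+\mathcal S_\star$. For $\mathcal L\in\mathbb R^{I_1\times R\times I_3}$, $\mathcal R\in\mathbb R^{I_2\times R\times I_3}$ put $$\operatorname{dist}(\mathcal L,\mathcal R;\mathcal L_\star,\mathcal R_\star)=\inf_{\mathcal Q\in\mathrm{GL}(R)}\Bigl(\|(\mathcal L*\mathcal Q-\mathcal L_\star)*\mathit\Sigma_\star^{1/2}\|_{\mathrm F}^2+\|(\mathcal R*\mathcal Q^{-\top}-\mathcal R_\star)*\mathit\Sigma_\star^{1/2}\|_{\mathrm F}^2\Bigr)^{1/2},$$ and call $\mathcal Q\in\mathrm{GL}(R)$ an optimal alignment tensor between $[\mathcal L,\mathcal R]$ and $[\mathcal L_\star,\mathcal R_\star]$ if the infimum is attained at $\mathcal Q$. Fix $\eta\in[\frac14,\frac23]$, $\tau=1-0.6\eta$, $\zeta_1=\frac{3}{\sqrt{I_1I_2}}\mu R\,\sigma_{\min}(\mathcal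 X_\star)$ and $\zeta_{k+1}=\tau\zeta_k$ for $k\ge1$. From initial factors $\mathcal L_0,\mathcal R_0$ define, for $k\ge0$, $$\begin{aligned}\mathcal S_{k+1}&=\mathrm T_{\zeta_{k+1}}(\mathcal Y-\mathcal L_k*\mathcal R_k^\top),\\ \mathcal L_{k+1}&=\mathcal L_k-\eta(\mathcal L_k*\mathcal R_k^\top+\mathcal S_{k+1}-\mathcal Y)*\mathcal R_k*(\mathcal R_k^\top*\mathcal R_k)^{-1},\\ \mathcal R_{k+1}&=\mathcal R_k-\eta(\mathcal L_k*\mathcal R_k^\top+\mathcal S_{k+1}-\mathcal Y)^\top*\mathcal L_k*(\mathcal L_k^\top*\mathcal L_k)^{-1},\end{aligned}$$ let $\mathcal X_k=\mathcal L_k*\mathcal R_k^\top$, and let $\mathcal Q_k$ be an optimal alignment tensor between $[\mathcal L_k,\mathcal R_k]$ and $[\mathcal L_\star,\mathcal R_\star]$ (any one, whenever one exists). **Theorem (Local linear convergence).** Suppose that $$\operatorname{dist}(\mathcal L_0,\mathcal R_0;\mathcal L_\star,\mathcal R_\star)\le\frac{0.02}{\sqrt{I_3}}\sigma_{\min}(\mathcal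 X_\star),$$ $$\sqrt{I_1}\,\|(\mathcal L_0*\mathcal Q_0-\mathcal L_\star)*\mathit\Sigma_\star^{1/2}\|_{2,\infty}\vee\sqrt{I_2}\,\|(\mathcal R_0*\mathcal Q_0^{-\top}-\mathcal R_\star)*\mathit\Sigma_\star^{1/2}\|_{2,\infty}\le\sqrt{\mu R}\,\sigma_{\min}(\mathcal X_\star).$$ Then for every $k\ge0$ the tensors $\mathcal L_k^\top*\mathcal L_k$ and $\mathcal R_k^\top*\mathcal R_k$ are invertible (so the iterates are well defined), an optimal alignment tensor $\mathcal Q_k$ exists, and $$\operatorname{dist}(\mathcal L_k,\mathcal R_k;\mathcal L_\star,\mathcal R_\star)\le\frac{0.02}{\sqrt{I_3}}\tau^k\sigma_{\min}(\mathcal X_\star),$$ $$\sqrt{I_1}\,\|(\mathcal L_k*\mathcal Q_k-\mathcal L_\star)*\mathit\Sigma_\star^{1/2}\|_{2,\infty}\vee\sqrt{I_2}\,\|(\mathcal R_k*\mathcal Q_k^{-\top}-\mathcal R_\star)*\mathit\Sigma_\star^{1/2}\|_{2,\infty}\le\sqrt{\mu R}\,\tau^k\sigma_{\min}(\mathcal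 X_\star),$$ $$\|\mathcal X_\star-\mathcal X_k\|_\infty\le\frac{3}{\sqrt{I_1I_2}}\mu R\,\tau^k\sigma_{\min}(\mathcal X_\star).$$ -/

import Mathlib

noncomputable section

/-- Real order-3 tensors of size `m × n × p`, given by their frontal slices: `A k i j` is the entry
in row `i`, column `j` of the `k`-th frontal slice. The third mode is indexed cyclically, by
`0, …, p - 1` modulo `p`; the first frontal slice is `A 0`. -/
abbrev Tensor3 (m n p : ℕ) : Type := ZMod p → Matrix (Fin m) (Fin n) ℝ

namespace Tensor3

variable {m n q p : ℕ}

/-- The t-product: the tube `(i, j)` of the product is the sum over `s` of the circular convolutions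
of the tube `(i, s)` of `A` and the tube `(s, j)` of `B`. -/
def tprod [NeZero p] (A : Tensor3 m n p) (B : Tensor3 n q p) : Tensor3 m q p :=
  fun k => Matrix.of fun i j => ∑ s : Fin n, ∑ l : ZMod p, A l i s * B (k - l) s j

infixl:70 " ∗ₜ " => Tensor3.tprod

/-- The (conjugate) transpose of a real tensor: transpose every frontal slice and reverse the order
of all the slices but the first. -/
def transpose (A : Tensor3 m n p) : Tensor3 n m p := fun k => (A (-k)).transpose

/-- The identity tensor. -/
def identity (n p : ℕ) : Tensor3 n n p := fun k => if k = 0 then 1 else 0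

/-- `B` is the inverse tensor of `A`. -/
def IsInverse [NeZero p] (A B : Tensor3 n n p) : Prop :=
  A ∗ₜ B = identity n p ∧ B ∗ₜ A = identity n p

/-- Invertible tensors. -/
def IsInvertible [NeZero p] (A : Tensor3 n n p) : Prop := ∃ B, IsInverse A B

open Classical in
/-- The inverse tensor (and `0` when `A` is not invertible). -/
def inv [NeZero p] (A : Tensor3 n n p) : Tensor3 n n p :=
  if h : IsInvertible A then h.choose else 0

/-- The discrete Fourier transform along the third mode; `fft A k` is the `k`-th frontal slice. -/
def fft [NeZero p] (A : Tensor3 m n p) : ZMod p → Matrix (Fin m) (Fin n) ℂ :=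
  ZMod.dft fun k => (A k).map ((↑) : ℝ → ℂ)

/-- The multi-rank: the ranks of the frontal slices in the Fourier domain. -/
def multiRank [NeZero p] (A : Tensor3 m n p) (k : ZMod p) : ℕ := (fft A k).rank

/-- The tubal rank: the largest entry of the multi-rank. -/
def tubalRank [NeZero p] (A : Tensor3 m n p) : ℕ := Finset.univ.sup (multiRank A)

/-- The smallest nonzero singular value of all the frontal slices in the Fourier domain. -/
def sigmaMin [NeZero p] (A : Tensor3 m n p) : ℝ :=
  sInf {s : ℝ | 0 < s ∧ ∃ (k : ZMod p) (i : ℕ),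
    s = (Matrix.toEuclideanLin (fft A k)).singularValues i}

/-- Frobenius norm. -/
def frobNorm [NeZero p] (A : Tensor3 m n p) : ℝ := √(∑ k, ∑ i, ∑ j, A k i j ^ 2)

/-- `ℓ_{2,∞}` norm: the largest Euclidean norm of a horizontal slice. -/
def twoInfNorm [NeZero p] (A : Tensor3 m n p) : ℝ := ⨆ i : Fin m, √(∑ j, ∑ k, A k i j ^ 2)

/-- Infinity norm: the largest absolute value of an entry. -/
def infNorm (A : Tensor3 m n p) : ℝ :=
  ⨆ x : Fin m × Fin n × ZMod p, |A x.2.2 x.1 x.2.1|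

/-- Every frontal slice is a diagonal matrix. -/
def IsFDiagonal (A : Tensor3 n n p) : Prop := ∀ k, (A k).IsDiag

/-- The square root of an f-diagonal tensor whose frontal slices in the Fourier domain have real
nonnegative diagonals: take the square roots of these diagonals and transform back. -/
def sqrtFDiag [NeZero p] (S : Tensor3 n n p) : Tensor3 n n p :=
  fun k => ((ZMod.dft (N := p)).symm
    (fun l => Matrix.diagonal fun i => ((√((fft S l i i).re) : ℝ) : ℂ)) k).map Complex.re

/-- `X = U * S * Vᵀ` is a skinny t-SVD with `r` singular tubes: `U` and `V` have orthonormal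
lateral slices, `S` is f-diagonal, and in the Fourier domain the diagonal entries of `S` (which are
then singular values of the slices of `X`) are real and nonnegative. -/
structure IsSkinnyTSVD [NeZero p] {r : ℕ} (X : Tensor3 m n p) (U : Tensor3 m r p)
    (S : Tensor3 r r p) (V : Tensor3 n r p) : Prop where
  eq_prod : X = U ∗ₜ S ∗ₜ transpose V
  left_orth : transpose U ∗ₜ U = identity r p
  right_orth : transpose V ∗ₜ V = identity r p
  fdiag : IsFDiagonal S
  sv_real : ∀ k i, (fft S k i i).im = 0
  sv_nonneg : ∀ k i, 0 ≤ (fft S k i i).re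

/-- Tensor `μ`-incoherence of the singular tensors `U` and `V`. -/
def IsIncoherent [NeZero p] {r : ℕ} (μ : ℝ) (U : Tensor3 m r p) (V : Tensor3 n r p) : Prop :=
  twoInfNorm U ≤ √(μ * r / m) ∧ twoInfNorm V ≤ √(μ * r / n)

/-- At most a fraction `α` of the entries of each horizontal, lateral and frontal slice is
nonzero. -/
def IsSparse [NeZero p] (α : ℝ) (A : Tensor3 m n p) : Prop :=
  (∀ i : Fin m, (({x : Fin n × ZMod p | A x.2 i x.1 ≠ 0} : Set _).ncard : ℝ) ≤ α * (n * p)) ∧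
  (∀ j : Fin n, (({x : Fin m × ZMod p | A x.2 x.1 j ≠ 0} : Set _).ncard : ℝ) ≤ α * (m * p)) ∧
  (∀ k : ZMod p, (({x : Fin m × Fin n | A k x.1 x.2 ≠ 0} : Set _).ncard : ℝ) ≤ α * (m * n))

/-- Entrywise soft thresholding. -/
def softThreshold (ζ : ℝ) (A : Tensor3 m n p) : Tensor3 m n p :=
  fun k => Matrix.of fun i j => Real.sign (A k i j) * max 0 (|A k i j| - ζ)

section Alignment

variable [NeZero p] {r : ℕ}

/-- The error `(L * Q - L⋆) * Σ⋆^{1/2}` of the left factor aligned by `Q`, with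
`L⋆ = U⋆ * Σ⋆^{1/2}`. -/
def leftError (U : Tensor3 m r p) (S : Tensor3 r r p) (L : Tensor3 m r p) (Q : Tensor3 r r p) :
    Tensor3 m r p :=
  (L ∗ₜ Q - U ∗ₜ sqrtFDiag S) ∗ₜ sqrtFDiag S

/-- The error `(R * Q^{-⊤} - R⋆) * Σ⋆^{1/2}` of the right factor aligned by `Q`, with
`R⋆ = V⋆ * Σ⋆^{1/2}`. -/
def rightError (V : Tensor3 n r p) (S : Tensor3 r r p) (R : Tensor3 n r p) (Q : Tensor3 r r p) :
    Tensor3 n r p :=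
  (R ∗ₜ transpose (inv Q) - V ∗ₜ sqrtFDiag S) ∗ₜ sqrtFDiag S

/-- The quantity whose infimum over invertible `Q` is the distance. -/
def alignError (U : Tensor3 m r p) (S : Tensor3 r r p) (V : Tensor3 n r p)
    (L : Tensor3 m r p) (R : Tensor3 n r p) (Q : Tensor3 r r p) : ℝ :=
  √(frobNorm (leftError U S L Q) ^ 2 + frobNorm (rightError V S R Q) ^ 2)

/-- `dist(L, R; L⋆, R⋆)`, where `L⋆ = U * S^{1/2}` and `R⋆ = V * S^{1/2}`. -/
def factorDist (U : Tensor3 m r p) (S : Tensor3 r r p) (V : Tensor3 n r p)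
    (L : Tensor3 m r p) (R : Tensor3 n r p) : ℝ :=
  ⨅ Q : {Q : Tensor3 r r p // IsInvertible Q}, alignError U S V L R Q

/-- `Q` is an optimal alignment tensor between `[L, R]` and `[L⋆, R⋆]`: it is invertible and the
infimum that defines the distance is attained at `Q`. -/
def IsOptimalAlignment (U : Tensor3 m r p) (S : Tensor3 r r p) (V : Tensor3 n r p)
    (L : Tensor3 m r p) (R : Tensor3 n r p) (Q : Tensor3 r r p) : Prop :=
  IsInvertible Q ∧ ∀ P, IsInvertible P → alignError U S V L R Q ≤ alignError U S V L R P

/-- The larger of `√m ‖(L * Q - L⋆) * Σ⋆^{1/2}‖_{2,∞}` and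
`√n ‖(R * Q^{-⊤} - R⋆) * Σ⋆^{1/2}‖_{2,∞}`. -/
def incoherenceError (U : Tensor3 m r p) (S : Tensor3 r r p) (V : Tensor3 n r p)
    (L : Tensor3 m r p) (R : Tensor3 n r p) (Q : Tensor3 r r p) : ℝ :=
  max (√m * twoInfNorm (leftError U S L Q)) (√n * twoInfNorm (rightError V S R Q))

/-- The sequences `S`, `L`, `R` are produced by the iterations of RTPCA-SGD on the observation `Y`,
with constant step size `η` and thresholding values `ζ`, starting from `L 0` and `R 0`. -/
def IsRTPCASGD (Y : Tensor3 m n p) (η : ℝ) (ζ : ℕ → ℝ) (S : ℕ → Tensor3 m n p)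
    (L : ℕ → Tensor3 m r p) (R : ℕ → Tensor3 n r p) : Prop :=
  ∀ k,
    S (k + 1) = softThreshold (ζ (k + 1)) (Y - L k ∗ₜ transpose (R k)) ∧
    L (k + 1) = L k - η • ((L k ∗ₜ transpose (R k) + S (k + 1) - Y) ∗ₜ R k ∗ₜ
      inv (transpose (R k) ∗ₜ R k)) ∧
    R (k + 1) = R k - η • (transpose (L k ∗ₜ transpose (R k) + S (k + 1) - Y) ∗ₜ L k ∗ₜ
      inv (transpose (L k) ∗ₜ L k))

end Alignment

end Tensor3

end

open Tensor3

/-! Passing to block circulant matrices (`bcirc`) turns t-product, transpose and identity into those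
of real matrices. It preserves the row norms and the largest entry and multiplies the Frobenius norm
by `√p`, so the analysis concerns ordinary matrices. The Fourier transform is needed only for Σ⋆:
its square root is real and symmetric, and `‖Σ⋆⁻¹‖ ≤ 1/σ_min`.

Let `D_L`, `D_R` be the aligned errors times Σ⋆^{1/2}, and `F = D Σ⋆⁻¹`, so that `‖F‖ ≤ 1/50`. Then
`L Q = (U + F_L) Σ⋆^{1/2}`, similarly for `R`, and `X - X⋆ = D_L (V + F_R)ᵀ + U D_Rᵀ`. A step with
the alignment held fixed gives `D_L' = (1 - η) D_L - η U D_Rᵀ P_R - η E P_R`, where `P_R = (V +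
F_R)((V + F_R)ᵀ(V + F_R))⁻¹` is close to `V` and `E` is the error of the sparse part
(`exists_leftError_step`). The cross term of the energy is `⟨Uᵀ D_L, D_Rᵀ V⟩`. First order
optimality of the alignment makes these two matrices almost equal
(`IsOptimalAlignment.transpose_mul_eq`), so the term is almost nonnegative and the energy contracts
(`scaled_step_energy_le`).

Incoherence bounds the entries of `X_k - X⋆` by the next threshold (`abs_product_sub_le`). Hence
thresholding adds nothing outside the support of S⋆ and errs by at most twice the threshold on it
(`abs_softThreshold_sub_le`); sparsity then makes `E P_R` small, in Frobenius norm by Schur's test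
and row by row directly.

The row bounds contract by `1 - 0.97 η` for the old alignment. A new optimal alignment exists by
compactness (`exists_isOptimalAlignment`). Both alignments have small Frobenius error, so changing
from one to the other moves the rows little (`vecNorm_realign_le`), and the final rate is `1 - 0.6
η`. -/

noncomputable section

namespace Matrix

open scoped Matrix.Norms.L2Operator

/-! ### Frobenius, operator and row norms of real matrices. -/

section FrobeniusNorm

set_option linter.unusedSectionVars false

variable {ι κ ρ : Type*} [Fintype ι] [Fintype κ] [Fintype ρ]

/-- The Frobenius norm of a real matrix. -/
def frob (A : Matrix ι κ ℝ) : ℝ := ‖WithLp.toLp 2 fun x : ι × κ => A x.1 x.2‖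

/-- The Euclidean norm of a real vector. -/
def vecNorm (x : ι → ℝ) : ℝ := ‖WithLp.toLp 2 x‖

variable [DecidableEq ι] [DecidableEq κ] [DecidableEq ρ]

theorem vecNorm_nonneg (x : ι → ℝ) : 0 ≤ vecNorm x := norm_nonneg _

theorem vecNorm_sq (x : ι → ℝ) : vecNorm x ^ 2 = ∑ i, x i ^ 2 := by
  simp [vecNorm, EuclideanSpace.norm_sq_eq]

theorem vecNorm_add_le (x y : ι → ℝ) : vecNorm (x + y) ≤ vecNorm x + vecNorm y := norm_add_le _ _

theorem vecNorm_sub_le (x y : ι → ℝ) : vecNorm (x - y) ≤ vecNorm x + vecNorm y := norm_sub_le _ _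

theorem vecNorm_smul (c : ℝ) (x : ι → ℝ) : vecNorm (c • x) = |c| * vecNorm x := norm_smul c _

theorem vecNorm_sum_le (s : Finset κ) (f : κ → ι → ℝ) :
    vecNorm (∑ i ∈ s, f i) ≤ ∑ i ∈ s, vecNorm (f i) := by
  have := norm_sum_le s fun i => WithLp.toLp 2 (f i)
  rwa [← WithLp.toLp_sum] at this

theorem abs_dotProduct_le (x y : ι → ℝ) : |x ⬝ᵥ y| ≤ vecNorm x * vecNorm y := by
  have := abs_real_inner_le_norm (WithLp.toLp 2 y) (WithLp.toLp 2 x)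
  rw [EuclideanSpace.inner_toLp_toLp] at this
  simpa [vecNorm, mul_comm] using this

theorem vecNorm_mulVec_le (A : Matrix ι κ ℝ) (x : κ → ℝ) :
    vecNorm (A *ᵥ x) ≤ ‖A‖ * vecNorm x := by
  exact l2_opNorm_mulVec A (WithLp.toLp 2 x)

theorem l2_opNorm_transpose (A : Matrix ι κ ℝ) : ‖Aᵀ‖ = ‖A‖ := by
  rw [← l2_opNorm_conjTranspose A, conjTranspose_eq_transpose_of_trivial]

theorem vecNorm_vecMul_le (x : ι → ℝ) (A : Matrix ι κ ℝ) :
    vecNorm (x ᵥ* A) ≤ vecNorm x * ‖A‖ := by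
  rw [← mulVec_transpose, mul_comm, ← l2_opNorm_transpose]
  exact vecNorm_mulVec_le _ _

theorem l2_opNorm_le (A : Matrix ι κ ℝ) {c : ℝ} (hc : 0 ≤ c)
    (h : ∀ x, vecNorm (A *ᵥ x) ≤ c * vecNorm x) : ‖A‖ ≤ c := by
  rw [l2_opNorm_def]
  exact ContinuousLinearMap.opNorm_le_bound _ hc fun x => h x.ofLp

theorem frob_nonneg (A : Matrix ι κ ℝ) : 0 ≤ frob A := norm_nonneg _

theorem frob_sq (A : Matrix ι κ ℝ) : frob A ^ 2 = ∑ i, ∑ j, A i j ^ 2 := by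
  simp [frob, EuclideanSpace.norm_sq_eq, Fintype.sum_prod_type]

theorem frob_sq_rows (A : Matrix ι κ ℝ) : frob A ^ 2 = ∑ i, vecNorm (A i) ^ 2 := by
  simp [frob_sq, vecNorm_sq]

theorem frob_add_le (A B : Matrix ι κ ℝ) : frob (A + B) ≤ frob A + frob B :=
  norm_add_le (WithLp.toLp 2 fun x : ι × κ => A x.1 x.2) (WithLp.toLp 2 fun x : ι × κ => B x.1 x.2)

theorem frob_sub_le (A B : Matrix ι κ ℝ) : frob (A - B) ≤ frob A + frob B :=
  norm_sub_le (WithLp.toLp 2 fun x : ι × κ => A x.1 x.2) (WithLp.toLp 2 fun x : ι × κ => B x.1 x.2)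

theorem frob_smul (c : ℝ) (A : Matrix ι κ ℝ) : frob (c • A) = |c| * frob A :=
  norm_smul c (WithLp.toLp 2 fun x : ι × κ => A x.1 x.2)

theorem frob_transpose (A : Matrix ι κ ℝ) : frob Aᵀ = frob A := by
  rw [← sq_eq_sq₀ (frob_nonneg _) (frob_nonneg _), frob_sq, frob_sq, Finset.sum_comm]
  simp

theorem frob_sq_eq_trace (A : Matrix ι κ ℝ) : frob A ^ 2 = trace (Aᵀ * A) := by
  rw [frob_sq, Finset.sum_comm]
  simp [trace, mul_apply, sq]

theorem frob_eq_zero {A : Matrix ι κ ℝ} (h : frob A = 0) : A = 0 := by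
  ext i j
  have h1 := frob_sq A
  rw [h, zero_pow two_ne_zero, ← Fintype.sum_prod_type', eq_comm,
    Finset.sum_eq_zero_iff_of_nonneg fun _ _ => sq_nonneg _] at h1
  simpa using h1 (i, j) (Finset.mem_univ _)

theorem mul_row (A : Matrix ι κ ℝ) (B : Matrix κ ρ ℝ) (i : ι) : (A * B) i = A i ᵥ* B := rfl

theorem frob_mul_le_right (A : Matrix ι κ ℝ) (B : Matrix κ ρ ℝ) :
    frob (A * B) ≤ frob A * ‖B‖ := by
  rw [← sq_le_sq₀ (frob_nonneg _) (mul_nonneg (frob_nonneg _) (norm_nonneg _)), mul_pow,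
    frob_sq_rows, frob_sq_rows, Finset.sum_mul]
  refine Finset.sum_le_sum fun i _ => ?_
  rw [← mul_pow]
  exact pow_le_pow_left₀ (vecNorm_nonneg _) (vecNorm_vecMul_le _ _) 2

theorem frob_mul_le_left (A : Matrix ι κ ℝ) (B : Matrix κ ρ ℝ) :
    frob (A * B) ≤ ‖A‖ * frob B := by
  rw [← frob_transpose, transpose_mul, mul_comm ‖A‖, ← frob_transpose B, ← l2_opNorm_transpose A]
  exact frob_mul_le_right _ _

theorem l2_opNorm_le_frob (A : Matrix ι κ ℝ) : ‖A‖ ≤ frob A := by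
  refine l2_opNorm_le A (frob_nonneg _) fun x => ?_
  rw [← sq_le_sq₀ (vecNorm_nonneg _) (mul_nonneg (frob_nonneg _) (vecNorm_nonneg _)), mul_pow,
    frob_sq_rows, vecNorm_sq, Finset.sum_mul]
  refine Finset.sum_le_sum fun i _ => ?_
  rw [← mul_pow]
  exact sq_le_sq.2 ((abs_dotProduct_le (A i) x).trans (le_abs_self _))

theorem frob_one : frob (1 : Matrix ρ ρ ℝ) = √(Fintype.card ρ) := by
  rw [← Real.sqrt_sq (frob_nonneg _), frob_sq]
  simp [one_apply]

theorem l2_opNorm_one_le : ‖(1 : Matrix ρ ρ ℝ)‖ ≤ 1 :=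
  l2_opNorm_le _ zero_le_one fun x => by simp

theorem frob_isometry_mul {U : Matrix ι κ ℝ} (hU : Uᵀ * U = 1)
    (A : Matrix κ ρ ℝ) : frob (U * A) = frob A := by
  rw [← sq_eq_sq₀ (frob_nonneg _) (frob_nonneg _), frob_sq_eq_trace, frob_sq_eq_trace,
    transpose_mul, Matrix.mul_assoc, ← Matrix.mul_assoc Uᵀ, hU, Matrix.one_mul]

theorem l2_opNorm_isometry_le {U : Matrix ι κ ℝ} (hU : Uᵀ * U = 1) : ‖U‖ ≤ 1 := by
  have h : ‖Uᵀ * U‖ ≤ 1 := hU ▸ l2_opNorm_one_le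
  rw [← conjTranspose_eq_transpose_of_trivial, l2_opNorm_conjTranspose_mul_self] at h
  nlinarith [norm_nonneg U]

/-- Schur's test for the Frobenius norm of a product. -/
theorem frob_mul_le_of_sum_le (E : Matrix ι κ ℝ) (P : Matrix κ ρ ℝ) {a b : ℝ} (ha : 0 ≤ a)
    (hrow : ∀ i, ∑ j, |E i j| ≤ a) (hcol : ∀ j, ∑ i, |E i j| ≤ b) :
    frob (E * P) ^ 2 ≤ a * b * frob P ^ 2 := by
  have key : ∀ i l, (E * P) i l ^ 2 ≤ a * ∑ j, |E i j| * P j l ^ 2 := fun i l => by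
    have h := Finset.sum_sq_le_sum_mul_sum_of_sq_le_mul Finset.univ (r := fun j => E i j * P j l)
      (f := fun j => |E i j|) (g := fun j => |E i j| * P j l ^ 2) (fun _ _ => abs_nonneg _)
      (fun _ _ => by positivity)
      (fun j _ => by rw [← mul_assoc, abs_mul_abs_self, mul_pow, sq (E i j)])
    rw [mul_apply]
    exact h.trans (mul_le_mul_of_nonneg_right (hrow i) (by positivity))
  rw [frob_sq]
  calc ∑ i, ∑ l, (E * P) i l ^ 2
      ≤ ∑ i, ∑ l, a * ∑ j, |E i j| * P j l ^ 2 :=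
        Finset.sum_le_sum fun i _ => Finset.sum_le_sum fun l _ => key i l
    _ = a * ∑ j, (∑ i, |E i j|) * ∑ l, P j l ^ 2 := by
        simp_rw [← Finset.mul_sum, Finset.sum_mul]
        congr 1
        rw [Finset.sum_comm (s := Finset.univ (α := κ))]
        refine Finset.sum_congr rfl fun i _ => ?_
        rw [Finset.sum_comm]
        simp_rw [Finset.mul_sum]
    _ ≤ a * ∑ j, b * ∑ l, P j l ^ 2 :=
        mul_le_mul_of_nonneg_left (Finset.sum_le_sum fun j _ =>
          mul_le_mul_of_nonneg_right (hcol j) (by positivity)) ha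
    _ = a * b * frob P ^ 2 := by rw [← Finset.mul_sum, frob_sq, mul_assoc]

theorem vecNorm_mul_row_le (E : Matrix ι κ ℝ) (P : Matrix κ ρ ℝ) (i : ι) {a c : ℝ} (hc : 0 ≤ c)
    (hrow : ∑ j, |E i j| ≤ a) (hP : ∀ j, vecNorm (P j) ≤ c) :
    vecNorm ((E * P) i) ≤ a * c := by
  have h : (E * P) i = ∑ j, E i j • P j := by
    ext l
    simp [mul_apply]
  rw [h]
  calc vecNorm (∑ j, E i j • P j) ≤ ∑ j, vecNorm (E i j • P j) := vecNorm_sum_le _ _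
    _ ≤ ∑ j, |E i j| * c := Finset.sum_le_sum fun j _ => by
        rw [vecNorm_smul]
        exact mul_le_mul_of_nonneg_left (hP j) (abs_nonneg _)
    _ ≤ a * c := by
        rw [← Finset.sum_mul]
        exact mul_le_mul_of_nonneg_right hrow hc

end FrobeniusNorm

end Matrix

end

noncomputable section

namespace Matrix

open scoped Matrix.Norms.L2Operator

/-! ### Matrix inequalities for one scaled gradient step. -/

section ScaledStep

variable {ι κ ρ : Type*} [Fintype ι] [Fintype κ] [Fintype ρ]
variable [DecidableEq ι] [DecidableEq κ] [DecidableEq ρ]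

/-- Here and below `V` is a singular factor and `V + F` the current factor after alignment and
rescaling. Its Gram matrix stays near the identity, which makes the preconditioner harmless. -/
theorem norm_gram_sub_one_le {V F : Matrix κ ρ ℝ} {f : ℝ} (hV : Vᵀ * V = 1) (hF : ‖F‖ ≤ f) :
    ‖(V + F)ᵀ * (V + F) - 1‖ ≤ 2 * f + f ^ 2 := by
  have h : (V + F)ᵀ * (V + F) - 1 = Vᵀ * F + Fᵀ * V + Fᵀ * F := by
    rw [transpose_add, Matrix.add_mul, Matrix.mul_add, Matrix.mul_add, hV]
    abel
  have hf : 0 ≤ f := (norm_nonneg _).trans hF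
  have hV1 := l2_opNorm_isometry_le hV
  have h1 : ‖Vᵀ * F‖ ≤ 1 * f := (l2_opNorm_mul _ _).trans <| by
    rw [l2_opNorm_transpose]
    exact mul_le_mul hV1 hF (norm_nonneg _) zero_le_one
  have h2 : ‖Fᵀ * V‖ ≤ f * 1 := (l2_opNorm_mul _ _).trans <| by
    rw [l2_opNorm_transpose]
    exact mul_le_mul hF hV1 (norm_nonneg _) hf
  have h3 : ‖Fᵀ * F‖ ≤ f * f := (l2_opNorm_mul _ _).trans <| by
    rw [l2_opNorm_transpose]
    exact mul_le_mul hF hF (norm_nonneg _) hf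
  rw [h]
  have := norm_add₃_le (a := Vᵀ * F) (b := Fᵀ * V) (c := Fᵀ * F)
  linarith

theorem isUnit_gram {V F : Matrix κ ρ ℝ} (hV : Vᵀ * V = 1) (hF : ‖F‖ ≤ 1 / 10) :
    IsUnit ((V + F)ᵀ * (V + F)) := by
  have h := norm_gram_sub_one_le hV hF
  rw [norm_sub_rev] at h
  simpa using isUnit_one_sub_of_norm_lt_one (h.trans_lt (by norm_num))

/-- With `G` the Gram matrix, `C = 1 - (G - 1) C` lets `‖C‖` be absorbed on the left; `101/2500 =
2/50 + 1/50²`. -/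
theorem norm_gram_inv_le {V F : Matrix κ ρ ℝ} {C : Matrix ρ ρ ℝ} (hV : Vᵀ * V = 1)
    (hF : ‖F‖ ≤ 1 / 50) (hC : (V + F)ᵀ * (V + F) * C = 1) : ‖C‖ ≤ 21 / 20 := by
  have h : ‖(V + F)ᵀ * (V + F) - 1‖ ≤ 101 / 2500 :=
    (norm_gram_sub_one_le hV hF).trans_eq (by norm_num)
  have hC' : C = 1 - ((V + F)ᵀ * (V + F) - 1) * C := by
    rw [Matrix.sub_mul, hC, Matrix.one_mul]
    abel
  have h1 : ‖C‖ ≤ 1 + 101 / 2500 * ‖C‖ := by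
    conv_lhs => rw [hC']
    refine (norm_sub_le _ _).trans (add_le_add l2_opNorm_one_le ?_)
    exact (l2_opNorm_mul _ _).trans (mul_le_mul_of_nonneg_right h (norm_nonneg _))
  linarith

theorem norm_mul_gram_inv_le {V F : Matrix κ ρ ℝ} {C : Matrix ρ ρ ℝ} (hV : Vᵀ * V = 1)
    (hF : ‖F‖ ≤ 1 / 50) (hC : (V + F)ᵀ * (V + F) * C = 1) : ‖(V + F) * C‖ ≤ 1071 / 1000 := by
  have h1 := norm_gram_inv_le hV hF hC
  have h2 : ‖V + F‖ ≤ 51 / 50 := by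
    have := norm_add_le V F
    have := l2_opNorm_isometry_le hV
    linarith
  refine (l2_opNorm_mul _ _).trans ((mul_le_mul h2 h1 (norm_nonneg _) (by norm_num)).trans ?_)
  norm_num

/-- Since `G C = 1` for the Gram matrix `G`, the difference is `(F - V (G - 1)) C`, of norm at most
`(1/50 + 101/2500) · 21/20`. -/
theorem norm_mul_gram_inv_sub_le {V F : Matrix κ ρ ℝ} {C : Matrix ρ ρ ℝ} (hV : Vᵀ * V = 1)
    (hF : ‖F‖ ≤ 1 / 50) (hC : (V + F)ᵀ * (V + F) * C = 1) :
    ‖(V + F) * C - V‖ ≤ 635 / 10000 := by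
  have h1 := norm_gram_inv_le hV hF hC
  have h : (V + F) * C - V = (F - V * ((V + F)ᵀ * (V + F) - 1)) * C := by
    rw [Matrix.sub_mul, Matrix.mul_assoc V, Matrix.sub_mul, hC, Matrix.mul_sub, Matrix.add_mul,
      Matrix.one_mul, Matrix.mul_one]
    abel
  have h2 : ‖V * ((V + F)ᵀ * (V + F) - 1)‖ ≤ 1 * (101 / 2500) :=
    (l2_opNorm_mul _ _).trans (mul_le_mul (l2_opNorm_isometry_le hV)
      ((norm_gram_sub_one_le hV hF).trans_eq (by norm_num)) (norm_nonneg _) zero_le_one)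
  have h3 := norm_sub_le F (V * ((V + F)ᵀ * (V + F) - 1))
  have h4 : ‖F - V * ((V + F)ᵀ * (V + F) - 1)‖ ≤ 151 / 2500 := by linarith
  rw [h]
  refine (l2_opNorm_mul _ _).trans ((mul_le_mul h4 h1 (norm_nonneg _) (by norm_num)).trans ?_)
  norm_num

theorem frob_smul_sub_smul_sq (c d : ℝ) (X Y : Matrix ι κ ℝ) :
    frob (c • X - d • Y) ^ 2 =
      c ^ 2 * frob X ^ 2 - 2 * c * d * trace (Xᵀ * Y) + d ^ 2 * frob Y ^ 2 := by
  have h : trace (Yᵀ * X) = trace (Xᵀ * Y) := by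
    rw [← trace_transpose, transpose_mul, transpose_transpose]
  simp only [frob_sq_eq_trace, transpose_sub, transpose_smul, Matrix.sub_mul, Matrix.mul_sub,
    Matrix.smul_mul, Matrix.mul_smul, trace_sub, trace_smul, smul_eq_mul, h]
  ring

/-- The numbers stand for Frobenius norms: `a`, `b` of `D_L`, `D_R`; `A`, `B` of `Uᵀ D_L`, `D_Rᵀ V`;
`q` of their difference; `p` is their inner product. Eliminating `A² + B² = 2p + q²` leaves `p` with
coefficient `-2η(2 - 3η)`, and `2p ≥ -q²` with `q` tiny. -/
theorem scaled_step_energy_le {η d a b p A B q x y : ℝ} (hη : η ∈ Set.Icc (1 / 4 : ℝ) (2 / 3))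
    (hq : 0 ≤ q) (hab : a ^ 2 + b ^ 2 ≤ d ^ 2)
    (hq' : q ≤ (a + b) / 50) (hpq : A ^ 2 + B ^ 2 - 2 * p = q ^ 2)
    (hx : x ^ 2 = (1 - η) ^ 2 * a ^ 2 - 2 * (1 - η) * η * p + η ^ 2 * B ^ 2)
    (hy : y ^ 2 = (1 - η) ^ 2 * b ^ 2 - 2 * (1 - η) * η * p + η ^ 2 * A ^ 2) :
    x ^ 2 + y ^ 2 ≤ ((1 - 0.99 * η) * d) ^ 2 := by
  obtain ⟨h1, h2⟩ := hη
  have hqq : q ^ 2 ≤ 0.0008 * d ^ 2 := by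
    have : q ^ 2 ≤ ((a + b) / 50) ^ 2 := pow_le_pow_left₀ hq hq' 2
    linarith [sq_nonneg (a - b)]
  have hp : 0 ≤ 2 * p + q ^ 2 := by linarith [sq_nonneg A, sq_nonneg B]
  have hη2 : η ^ 2 ≤ 2 / 3 * η := by nlinarith
  have e1 : x ^ 2 + y ^ 2 =
      (1 - η) ^ 2 * (a ^ 2 + b ^ 2) - η * (2 - 3 * η) * (2 * p) + η ^ 2 * q ^ 2 := by
    rw [hx, hy, ← hpq]
    ring
  -- The sign of `2 - 3η` is where `η ≤ 2/3` is needed.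
  have e2 : 0 ≤ η * (2 - 3 * η) * (2 * p + q ^ 2) :=
    mul_nonneg (mul_nonneg (by linarith) (by linarith)) hp
  have e3 : (1 - η) ^ 2 * (a ^ 2 + b ^ 2) ≤ (1 - η) ^ 2 * d ^ 2 :=
    mul_le_mul_of_nonneg_left hab (sq_nonneg _)
  have e4 : (2 * η - 2 * η ^ 2) * q ^ 2 ≤ (2 * η - 2 * η ^ 2) * (0.0008 * d ^ 2) :=
    mul_le_mul_of_nonneg_left hqq (by linarith)
  have e5 : 0 ≤ (0.02 * η - 0.0199 * η ^ 2 - 0.0016 * (η - η ^ 2)) * d ^ 2 :=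
    mul_nonneg (by linarith) (sq_nonneg _)
  rw [mul_pow]
  linarith

/-- The triangle inequality in the plane for the perturbation `(e, e)`, with `1.42` in place of
`√2`. -/
theorem sq_add_sq_le_of_le_add {x₀ y₀ x y X e : ℝ} (hx₀ : 0 ≤ x₀) (hy₀ : 0 ≤ y₀) (hx : 0 ≤ x)
    (hy : 0 ≤ y) (hX : 0 ≤ X) (he : 0 ≤ e) (hsum : x₀ ^ 2 + y₀ ^ 2 ≤ X ^ 2)
    (hxe : x ≤ x₀ + e) (hye : y ≤ y₀ + e) : x ^ 2 + y ^ 2 ≤ (X + 1.42 * e) ^ 2 := by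
  have hxy : x₀ + y₀ ≤ 1.42 * X := (sq_le_sq₀ (by positivity) (by positivity)).1
    (by linarith [sq_nonneg (x₀ - y₀), sq_nonneg X])
  have hx2 : x ^ 2 ≤ (x₀ + e) ^ 2 := pow_le_pow_left₀ hx hxe 2
  have hy2 : y ^ 2 ≤ (y₀ + e) ^ 2 := pow_le_pow_left₀ hy hye 2
  linarith [mul_le_mul_of_nonneg_left hxy he, sq_nonneg e]

theorem scaled_step_real {η s a b p A B q x₀ y₀ x y : ℝ} (hη : η ∈ Set.Icc (1 / 4 : ℝ) (2 / 3))
    (hs : 0 ≤ s) (ha : 0 ≤ a) (hb : 0 ≤ b) (hx₀ : 0 ≤ x₀) (hy₀ : 0 ≤ y₀) (hx : 0 ≤ x)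
    (hy : 0 ≤ y) (hq : 0 ≤ q) (hab : a ^ 2 + b ^ 2 ≤ (0.02 * s) ^ 2)
    (hq' : q ≤ (a + b) / 50) (hpq : A ^ 2 + B ^ 2 - 2 * p = q ^ 2)
    (hx₀' : x₀ ^ 2 = (1 - η) ^ 2 * a ^ 2 - 2 * (1 - η) * η * p + η ^ 2 * B ^ 2)
    (hy₀' : y₀ ^ 2 = (1 - η) ^ 2 * b ^ 2 - 2 * (1 - η) * η * p + η ^ 2 * A ^ 2)
    (hx' : x ≤ x₀ + η * (635 / 10000 * b + 7 / 10000 * s))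
    (hy' : y ≤ y₀ + η * (635 / 10000 * a + 7 / 10000 * s)) :
    x ^ 2 + y ^ 2 ≤ (0.02 * (1 - 0.6 * η) * s) ^ 2 := by
  have hη0 : 0 ≤ η := le_trans (by norm_num) hη.1
  have hη1 : 0 ≤ 1 - 0.99 * η := by linarith [hη.2]
  have hs' : 0 ≤ 0.02 * s := by linarith
  have ha' : a ≤ 0.02 * s := (sq_le_sq₀ ha hs').1 (by linarith [sq_nonneg b])
  have hb' : b ≤ 0.02 * s := (sq_le_sq₀ hb hs').1 (by linarith [sq_nonneg a])
  have hηs : 0 ≤ η * s := mul_nonneg hη0 hs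
  have hX : 0 ≤ (1 - 0.99 * η) * (0.02 * s) := mul_nonneg hη1 hs'
  -- `0.00197 = 0.0635 · 0.02 + 0.0007`: replacing `P_R` by `V`, plus the sparse error.
  have hxe : x ≤ x₀ + 0.00197 * (η * s) := by
    linarith [mul_le_mul_of_nonneg_left hb' hη0]
  have hye : y ≤ y₀ + 0.00197 * (η * s) := by
    linarith [mul_le_mul_of_nonneg_left ha' hη0]
  have he : 0 ≤ 0.00197 * (η * s) := by linarith
  refine (sq_add_sq_le_of_le_add hx₀ hy₀ hx hy hX he
    (scaled_step_energy_le hη hq hab hq' hpq hx₀' hy₀') hxe hye).trans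
    (pow_le_pow_left₀ (by linarith) ?_ 2)
  linarith

/-- Freezing `PR` at `V` isolates the main part of the step, whose energy can be computed exactly.
-/
theorem frob_scaled_step_le_add {U DL EL : Matrix ι ρ ℝ} {V DR PR : Matrix κ ρ ℝ} {η e δ : ℝ}
    (hη : 0 ≤ η) (hU : Uᵀ * U = 1) (hPR : ‖PR - V‖ ≤ δ) (hEL : frob EL ≤ e) :
    frob ((1 - η) • DL - η • (U * (DRᵀ * PR)) - η • EL) ≤
      frob ((1 - η) • DL - η • (U * (DRᵀ * V))) + η * (δ * frob DR + e) := by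
  have h : (1 - η) • DL - η • (U * (DRᵀ * PR)) - η • EL =
      (1 - η) • DL - η • (U * (DRᵀ * V)) - η • (U * (DRᵀ * (PR - V)) + EL) := by
    simp only [Matrix.mul_sub, smul_add, smul_sub]
    abel
  rw [h]
  refine (frob_sub_le _ _).trans (add_le_add_right ?_ _)
  rw [frob_smul, abs_of_nonneg hη]
  refine mul_le_mul_of_nonneg_left ((frob_add_le _ _).trans (add_le_add ?_ hEL)) hη
  rw [frob_isometry_mul hU]
  refine (frob_mul_le_right _ _).trans ?_
  rw [frob_transpose, mul_comm]
  exact mul_le_mul_of_nonneg_right hPR (frob_nonneg _)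

/-- One step of scaled gradient descent contracts the aligned Frobenius error, provided that the
alignment is optimal (`hopt`). -/
theorem frob_scaled_step_le {U FL PL DL EL : Matrix ι ρ ℝ} {V FR PR DR ER : Matrix κ ρ ℝ}
    {η s : ℝ} (hη : η ∈ Set.Icc (1 / 4 : ℝ) (2 / 3)) (hs : 0 ≤ s)
    (hU : Uᵀ * U = 1) (hV : Vᵀ * V = 1) (hFL : ‖FL‖ ≤ 1 / 50) (hFR : ‖FR‖ ≤ 1 / 50)
    (hopt : (U + FL)ᵀ * DL = DRᵀ * (V + FR))
    (hPL : ‖PL - U‖ ≤ 635 / 10000) (hPR : ‖PR - V‖ ≤ 635 / 10000)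
    (hEL : frob EL ≤ 7 / 10000 * s) (hER : frob ER ≤ 7 / 10000 * s)
    (hD : frob DL ^ 2 + frob DR ^ 2 ≤ (0.02 * s) ^ 2) :
    frob ((1 - η) • DL - η • (U * (DRᵀ * PR)) - η • EL) ^ 2 +
      frob ((1 - η) • DR - η • (V * (DLᵀ * PL)) - η • ER) ^ 2 ≤
      (0.02 * (1 - 0.6 * η) * s) ^ 2 := by
  have hη0 : 0 ≤ η := le_trans (by norm_num) hη.1
  -- Optimality balances the perturbed factors exactly; for `U` and `V` themselves the defect is of
  -- second order.
  have hq : Uᵀ * DL - DRᵀ * V = DRᵀ * FR - FLᵀ * DL := by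
    rw [transpose_add, Matrix.add_mul, Matrix.mul_add] at hopt
    rw [sub_eq_sub_iff_add_eq_add, hopt]
    abel
  have hq' : frob (Uᵀ * DL - DRᵀ * V) ≤ (frob DL + frob DR) / 50 := by
    rw [hq]
    have h1 := frob_sub_le (DRᵀ * FR) (FLᵀ * DL)
    have h2 := frob_mul_le_right DRᵀ FR
    have h3 := frob_mul_le_left FLᵀ DL
    rw [frob_transpose] at h2
    rw [l2_opNorm_transpose] at h3
    nlinarith [frob_nonneg DL, frob_nonneg DR]
  -- The left and right steps have the same cross term, so one number `p` serves both.
  have htr : trace (DLᵀ * (U * (DRᵀ * V))) = trace ((Uᵀ * DL)ᵀ * (DRᵀ * V)) := by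
    rw [transpose_mul, transpose_transpose, Matrix.mul_assoc]
  have htr' : trace (DRᵀ * (V * (DLᵀ * U))) = trace ((Uᵀ * DL)ᵀ * (DRᵀ * V)) := by
    rw [transpose_mul, transpose_transpose, ← Matrix.mul_assoc, trace_mul_comm]
  refine scaled_step_real (p := trace ((Uᵀ * DL)ᵀ * (DRᵀ * V))) (A := frob (Uᵀ * DL))
    (B := frob (DRᵀ * V)) hη hs (frob_nonneg DL) (frob_nonneg DR) (frob_nonneg _) (frob_nonneg _)
    (frob_nonneg _) (frob_nonneg _) (frob_nonneg _) hD hq' ?_ ?_ ?_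
    (frob_scaled_step_le_add hη0 hU hPR hEL) (frob_scaled_step_le_add hη0 hV hPL hER)
  · have h := frob_smul_sub_smul_sq 1 1 (Uᵀ * DL) (DRᵀ * V)
    rw [one_smul, one_smul] at h
    linarith
  · rw [frob_smul_sub_smul_sq, frob_isometry_mul hU, htr]
  · rw [frob_smul_sub_smul_sq, frob_isometry_mul hV, htr', ← frob_transpose (Uᵀ * DL),
      transpose_mul, transpose_transpose]

/-- Rowwise bound for one step of scaled gradient descent. -/
theorem vecNorm_scaled_step_le {U DL EL : Matrix ι ρ ℝ} {DR PR : Matrix κ ρ ℝ} {η s c : ℝ}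
    (hη : η ∈ Set.Icc (1 / 4 : ℝ) (2 / 3)) (hc : 0 ≤ c) (i : ι) (hU : vecNorm (U i) ≤ c)
    (hDL : vecNorm (DL i) ≤ c * s) (hDR : frob DR ≤ 0.02 * s) (hPR : ‖PR‖ ≤ 1071 / 1000)
    (hEL : vecNorm (EL i) ≤ 14 / 10000 * (c * s)) :
    vecNorm (((1 - η) • DL - η • (U * (DRᵀ * PR)) - η • EL) i) ≤ (1 - 0.97 * η) * (c * s) := by
  obtain ⟨h1, h2⟩ := hη
  have hb : ‖DRᵀ * PR‖ ≤ 0.02 * s * (1071 / 1000) := by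
    refine (l2_opNorm_mul _ _).trans (mul_le_mul ?_ hPR (norm_nonneg _) ?_)
    · rw [l2_opNorm_transpose]
      exact (l2_opNorm_le_frob _).trans hDR
    · exact (frob_nonneg _).trans hDR
  have hUi : vecNorm ((U * (DRᵀ * PR)) i) ≤ c * (0.02 * s * (1071 / 1000)) := by
    rw [mul_row]
    exact (vecNorm_vecMul_le _ _).trans (mul_le_mul hU hb (norm_nonneg _) hc)
  have h : ((1 - η) • DL - η • (U * (DRᵀ * PR)) - η • EL) i =
      (1 - η) • DL i - η • (U * (DRᵀ * PR)) i - η • EL i := rfl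
  have h3 := vecNorm_sub_le ((1 - η) • DL i - η • (U * (DRᵀ * PR)) i) (η • EL i)
  have h4 := vecNorm_sub_le ((1 - η) • DL i) (η • (U * (DRᵀ * PR)) i)
  rw [vecNorm_smul, abs_of_nonneg (by linarith)] at h3 h4
  rw [vecNorm_smul, abs_of_nonneg (by linarith)] at h4
  rw [h]
  have hcs : 0 ≤ c * s := (vecNorm_nonneg _).trans hDL
  have e1 := mul_le_mul_of_nonneg_left hDL (by linarith : 0 ≤ 1 - η)
  have e2 := mul_le_mul_of_nonneg_left hUi (by linarith : 0 ≤ η)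
  have e3 := mul_le_mul_of_nonneg_left hEL (by linarith : 0 ≤ η)
  nlinarith [mul_nonneg (by linarith : 0 ≤ η) hcs]

/-- The effect on the rows of the error of replacing one good alignment by another. -/
theorem vecNorm_realign_le {U F : Matrix ι ρ ℝ} {G K : Matrix ρ ρ ℝ} {s c : ℝ} (hc : 0 ≤ c)
    (hU : Uᵀ * U = 1) (hF : ‖F‖ ≤ 1 / 50) (i : ι) (hrow : vecNorm ((U + F) i) ≤ 2 * c)
    (h₁ : frob (F * G) ≤ 0.02 * s) (h₂ : frob (((U + F) * K - U) * G) ≤ 0.02 * s) :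
    vecNorm ((((U + F) * K - U) * G) i) ≤ vecNorm ((F * G) i) + 0.0818 * (c * s) := by
  -- `M` measures the change of alignment: the two errors differ by `(U + F) M`, of norm at most
  -- `0.04 s`.
  set M := (K - 1) * G with hM
  have hdiff : ((U + F) * K - U) * G = F * G + (U + F) * M := by
    rw [hM, ← Matrix.mul_assoc, Matrix.mul_sub, ← Matrix.add_mul, Matrix.mul_one]
    congr 1
    abel
  have h3 : frob ((U + F) * M) ≤ 0.04 * s := by
    have h : (U + F) * M = ((U + F) * K - U) * G - F * G := by
      rw [hdiff]
      abel
    rw [h]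
    linarith [frob_sub_le (((U + F) * K - U) * G) (F * G)]
  -- As `U` is an isometry and `F` is small, `M` itself is at most `0.04 s / 0.98`. Multiplied by
  -- the row bound `2c`, this gives the constant `0.0818`.
  have h4 : frob M ≤ 0.04 * s + 1 / 50 * frob M := by
    have h : U * M = (U + F) * M - F * M := by
      rw [Matrix.add_mul]
      abel
    rw [← frob_isometry_mul hU M, h, ← h, frob_isometry_mul hU]
    have e1 := frob_sub_le ((U + F) * M) (F * M)
    rw [← h, frob_isometry_mul hU] at e1
    have e2 := frob_mul_le_left F M
    have e3 := mul_le_mul_of_nonneg_right hF (frob_nonneg M)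
    linarith
  have h5 : ‖M‖ ≤ 0.0409 * s := by
    have := l2_opNorm_le_frob M
    have := frob_nonneg M
    linarith
  rw [hdiff]
  have h6 : (F * G + (U + F) * M) i = (F * G) i + (U + F) i ᵥ* M := rfl
  rw [h6]
  refine (vecNorm_add_le _ _).trans (add_le_add_right ?_ _)
  refine (vecNorm_vecMul_le _ _).trans
    ((mul_le_mul hrow h5 (norm_nonneg _) (by positivity)).trans_eq ?_)
  ring

end ScaledStep

end Matrix

end

noncomputable section

namespace Tensor3

open Matrix

open scoped Matrix.Norms.L2Operator

/-! ### Block circulant matrices. -/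

section BlockCirculant

variable {m n q p r : ℕ}

/-- The block circulant matrix of a tensor. -/
def bcirc (A : Tensor3 m n p) : Matrix (ZMod p × Fin m) (ZMod p × Fin n) ℝ :=
  Matrix.of fun x y => A (x.1 - y.1) x.2 y.2

theorem bcirc_apply (A : Tensor3 m n p) (x : ZMod p × Fin m) (y : ZMod p × Fin n) :
    bcirc A x y = A (x.1 - y.1) x.2 y.2 := rfl

theorem bcirc_injective : Function.Injective (bcirc : Tensor3 m n p → _) := by
  intro A B h
  funext k
  ext i j
  simpa [bcirc_apply] using congrFun (congrFun h (k, i)) (0, j)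

theorem bcirc_add (A B : Tensor3 m n p) : bcirc (A + B) = bcirc A + bcirc B := rfl

theorem bcirc_sub (A B : Tensor3 m n p) : bcirc (A - B) = bcirc A - bcirc B := rfl

theorem bcirc_smul (c : ℝ) (A : Tensor3 m n p) : bcirc (c • A) = c • bcirc A := rfl

theorem bcirc_transpose (A : Tensor3 m n p) : bcirc (transpose A) = (bcirc A)ᵀ := by
  ext x y
  simp [bcirc_apply, transpose]

theorem infNorm_le {A : Tensor3 m n p} {c : ℝ} (hc : 0 ≤ c)
    (h : ∀ x y, |bcirc A x y| ≤ c) : infNorm A ≤ c := by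
  refine Real.iSup_le (fun i => ?_) hc
  simpa [bcirc_apply] using h (i.2.2, i.1) (0, i.2.1)

theorem bcirc_identity : bcirc (identity n p) = 1 := by
  ext ⟨k, i⟩ ⟨l, j⟩
  by_cases h : k = l
  · simp [bcirc_apply, identity, one_apply, h]
  · simp [bcirc_apply, identity, one_apply, h, sub_eq_zero]

variable [NeZero p]

theorem bcirc_tprod (A : Tensor3 m n p) (B : Tensor3 n q p) :
    bcirc (A ∗ₜ B) = bcirc A * bcirc B := by
  ext x y
  rw [bcirc_apply, mul_apply, Fintype.sum_prod_type, Finset.sum_comm]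
  simp only [tprod, of_apply, bcirc_apply]
  refine Finset.sum_congr rfl fun s _ => ?_
  refine Fintype.sum_equiv (Equiv.subLeft x.1) _ _ fun l => ?_
  simp only [Equiv.subLeft_apply, sub_sub_cancel]
  rw [sub_right_comm]

theorem isInverse_iff {A B : Tensor3 n n p} : IsInverse A B ↔ bcirc A * bcirc B = 1 := by
  refine ⟨fun h => by rw [← bcirc_tprod, h.1, bcirc_identity], fun h => ⟨?_, ?_⟩⟩
  · exact bcirc_injective (by rw [bcirc_tprod, h, bcirc_identity])
  · exact bcirc_injective (by rw [bcirc_tprod, mul_eq_one_comm.1 h, bcirc_identity])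

/-- The matrix inverse must be shown to be block circulant. Left multiplication by `A` is an
injective endomorphism of the finite-dimensional space of tensors, so it reaches the identity. -/
theorem isInvertible_of_isUnit {A : Tensor3 n n p} (h : IsUnit (bcirc A)) : IsInvertible A := by
  let f : Tensor3 n n p →ₗ[ℝ] Tensor3 n n p :=
    { toFun := fun B => A ∗ₜ B
      map_add' := fun B C => bcirc_injective (by
        simp only [bcirc_tprod, bcirc_add, Matrix.mul_add])
      map_smul' := fun c B => bcirc_injective (by
        simp only [bcirc_tprod, bcirc_smul, Matrix.mul_smul, RingHom.id_apply]) }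
  have hf : Function.Injective f := fun B C hBC => by
    have h1 : bcirc A * bcirc B = bcirc A * bcirc C := by
      rw [← bcirc_tprod, ← bcirc_tprod]
      exact congrArg bcirc hBC
    exact bcirc_injective (h.mul_left_cancel h1)
  obtain ⟨B, hB⟩ := LinearMap.surjective_of_injective hf (identity n p)
  refine ⟨B, isInverse_iff.2 ?_⟩
  rw [← bcirc_tprod, ← bcirc_identity]
  exact congrArg bcirc hB

theorem bcirc_mul_bcirc_inv {A : Tensor3 n n p} (h : IsInvertible A) :
    bcirc A * bcirc (inv A) = 1 := by
  rw [inv, dif_pos h]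
  exact isInverse_iff.1 h.choose_spec

theorem bcirc_inv_mul_bcirc {A : Tensor3 n n p} (h : IsInvertible A) :
    bcirc (inv A) * bcirc A = 1 := mul_eq_one_comm.1 (bcirc_mul_bcirc_inv h)

theorem IsInverse.bcirc_inv_eq {A B : Tensor3 n n p} (h : IsInverse A B) : inv A = B := by
  refine bcirc_injective ?_
  have h1 := bcirc_inv_mul_bcirc ⟨B, h⟩
  have h2 := isInverse_iff.1 h
  calc bcirc (inv A) = bcirc (inv A) * (bcirc A * bcirc B) := by rw [h2, Matrix.mul_one]
    _ = bcirc B := by rw [← Matrix.mul_assoc, h1, Matrix.one_mul]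

/-- Every entry occurs `p` times; this is the source of the factor `1/√I₃` in the distance bounds.
-/
theorem frob_bcirc_sq (A : Tensor3 m n p) : frob (bcirc A) ^ 2 = p * frobNorm A ^ 2 := by
  rw [frobNorm, Real.sq_sqrt (by positivity), frob_sq, Fintype.sum_prod_type]
  simp only [Fintype.sum_prod_type, bcirc_apply]
  have h : ∀ k : ZMod p, ∑ i, ∑ l : ZMod p, ∑ j, A (k - l) i j ^ 2 = ∑ k, ∑ i, ∑ j, A k i j ^ 2 :=
    fun k => by
      rw [Finset.sum_comm]
      exact Fintype.sum_equiv (Equiv.subLeft k) _ _ fun l => rfl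
  rw [Finset.sum_congr rfl fun k _ => h k]
  simp [ZMod.card]

theorem vecNorm_bcirc_row (A : Tensor3 m n p) (x : ZMod p × Fin m) :
    vecNorm (bcirc A x) = √(∑ j, ∑ k, A k x.2 j ^ 2) := by
  rw [← Real.sqrt_sq (vecNorm_nonneg _), vecNorm_sq, Fintype.sum_prod_type, Finset.sum_comm]
  congr 1
  exact Finset.sum_congr rfl fun j _ => Fintype.sum_equiv (Equiv.subLeft x.1) _ _ fun l => rfl

theorem vecNorm_bcirc_row_le (A : Tensor3 m n p) (x : ZMod p × Fin m) :
    vecNorm (bcirc A x) ≤ twoInfNorm A := by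
  rw [vecNorm_bcirc_row]
  exact le_ciSup (f := fun i : Fin m => √(∑ j, ∑ k, A k i j ^ 2)) (Set.finite_range _).bddAbove x.2

theorem twoInfNorm_le {A : Tensor3 m n p} {c : ℝ} (hc : 0 ≤ c)
    (h : ∀ x, vecNorm (bcirc A x) ≤ c) : twoInfNorm A ≤ c := by
  refine Real.iSup_le (fun i => ?_) hc
  have := h (0, i)
  rwa [vecNorm_bcirc_row] at this

theorem abs_bcirc_le (A : Tensor3 m n p) (x y) : |bcirc A x y| ≤ infNorm A :=
  le_ciSup (f := fun x : Fin m × Fin n × ZMod p => |A x.2.2 x.1 x.2.1|)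
    (Set.finite_range _).bddAbove (x.2, y.2, x.1 - y.1)

end BlockCirculant

/-! ### Soft thresholding and sparsity. -/

section Sparse

variable {m n p : ℕ} [NeZero p]

/-- Where `s = 0`, only `d` is present and the threshold removes it. Elsewhere thresholding shifts
by at most `ζ`, on top of `|d| ≤ ζ`. -/
theorem abs_softThreshold_sub_le {ζ s d : ℝ} (hd : |d| ≤ ζ) :
    |Real.sign (s + d) * max 0 (|s + d| - ζ) - s| ≤ if s = 0 then 0 else 2 * ζ := by
  have h1 := abs_le.1 hd
  split_ifs with hs
  · subst hs
    simp [hd]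
  · rcases le_total (|s + d|) ζ with h | h
    · rw [max_eq_left (by linarith)]
      have := abs_le.1 h
      rw [mul_zero, zero_sub, abs_neg, abs_le]
      constructor <;> linarith
    · rw [max_eq_right (by linarith)]
      rcases lt_trichotomy (s + d) 0 with h2 | h2 | h2
      · rw [Real.sign_of_neg h2, abs_of_neg h2, abs_le]
        constructor <;> linarith
      · rw [h2, abs_zero] at h
        rw [h2, Real.sign_zero, zero_mul, zero_sub, abs_neg, abs_le]
        constructor <;> linarith
      · rw [Real.sign_of_pos h2, abs_of_pos h2, abs_le]
        constructor <;> linarith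

theorem softThreshold_sub_le {ζ : ℝ} {S D : Tensor3 m n p} (hD : infNorm D ≤ ζ) (x y) :
    |bcirc (softThreshold ζ (S + D) - S) x y| ≤ if bcirc S x y = 0 then 0 else 2 * ζ :=
  abs_softThreshold_sub_le (s := bcirc S x y) (d := bcirc D x y) ((abs_bcirc_le D x y).trans hD)

theorem sum_row_le_of_isSparse {α c : ℝ} {S E : Tensor3 m n p} (hS : IsSparse α S) (hc : 0 ≤ c)
    (hE : ∀ x y, |bcirc E x y| ≤ if bcirc S x y = 0 then 0 else c) (x) :
    ∑ y, |bcirc E x y| ≤ α * (n * p) * c := by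
  have h := hS.1 x.2
  -- Row `x` of the block circulant matrix is a rearrangement of the horizontal slice `x.2`.
  have h2 : ({y | bcirc S x y ≠ 0} : Set (ZMod p × Fin n)).ncard =
      ({z : Fin n × ZMod p | S z.2 x.2 z.1 ≠ 0} : Set _).ncard := by
    refine Set.ncard_congr (fun y _ => (y.2, x.1 - y.1)) (fun y hy => hy) ?_ ?_
    · rintro ⟨a, b⟩ ⟨a', b'⟩ _ _ hab
      simp_all
    · rintro ⟨j, k⟩ hjk
      exact ⟨(x.1 - k, j), by simpa [bcirc_apply] using hjk, by simp⟩
  calc ∑ y, |bcirc E x y| ≤ ∑ y, if bcirc S x y = 0 then 0 else c :=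
        Finset.sum_le_sum fun y _ => hE x y
    _ = ({y | bcirc S x y ≠ 0} : Set (ZMod p × Fin n)).ncard * c := by
        rw [Finset.sum_ite, Finset.sum_const_zero, zero_add, Finset.sum_const, nsmul_eq_mul,
          Set.ncard_eq_toFinset_card']
        congr 3
        ext
        simp
    _ ≤ α * (n * p) * c := by
        rw [h2]
        exact mul_le_mul_of_nonneg_right h hc

theorem sum_col_le_of_isSparse {α c : ℝ} {S E : Tensor3 m n p} (hS : IsSparse α S) (hc : 0 ≤ c)
    (hE : ∀ x y, |bcirc E x y| ≤ if bcirc S x y = 0 then 0 else c) (y) :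
    ∑ x, |bcirc E x y| ≤ α * (m * p) * c := by
  have h := hS.2.1 y.2
  have h2 : ({x | bcirc S x y ≠ 0} : Set (ZMod p × Fin m)).ncard =
      ({z : Fin m × ZMod p | S z.2 z.1 y.2 ≠ 0} : Set _).ncard := by
    refine Set.ncard_congr (fun x _ => (x.2, x.1 - y.1)) (fun x hx => hx) ?_ ?_
    · rintro ⟨a, b⟩ ⟨a', b'⟩ _ _ hab
      simp_all
    · rintro ⟨j, k⟩ hjk
      exact ⟨(k + y.1, j), by simpa [bcirc_apply] using hjk, by simp⟩
  calc ∑ x, |bcirc E x y| ≤ ∑ x, if bcirc S x y = 0 then 0 else c :=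
        Finset.sum_le_sum fun x _ => hE x y
    _ = ({x | bcirc S x y ≠ 0} : Set (ZMod p × Fin m)).ncard * c := by
        rw [Finset.sum_ite, Finset.sum_const_zero, zero_add, Finset.sum_const, nsmul_eq_mul,
          Set.ncard_eq_toFinset_card']
        congr 3
        ext
        simp
    _ ≤ α * (m * p) * c := by
        rw [h2]
        exact mul_le_mul_of_nonneg_right h hc

end Sparse

end Tensor3

end

noncomputable section

namespace Tensor3

open Matrix ZMod ComplexConjugate

/-! ### Fourier transform and f-diagonal tensors. -/

section Fourier

variable {m n q p r : ℕ} [NeZero p]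

theorem fft_apply (A : Tensor3 m n p) (k : ZMod p) (i : Fin m) (j : Fin n) :
    fft A k i j = ∑ l, stdAddChar (-(l * k)) * (A l i j : ℂ) := by
  simp [fft, dft_apply, Matrix.sum_apply]

theorem fft_injective : Function.Injective (fft : Tensor3 m n p → _) := by
  intro A B h
  funext k
  ext i j
  have := congrFun (congrFun (congrFun (ZMod.dft.injective h) k) i) j
  simpa using this

theorem fft_tprod (A : Tensor3 m n p) (B : Tensor3 n q p) (k : ZMod p) :
    fft (A ∗ₜ B) k = fft A k * fft B k := by
  ext i j
  simp only [mul_apply, fft_apply, tprod, of_apply, Complex.ofReal_sum, Complex.ofReal_mul,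
    Finset.mul_sum, Finset.sum_mul]
  rw [Finset.sum_comm]
  refine Finset.sum_congr rfl fun s _ => ?_
  rw [Finset.sum_comm]
  conv_rhs => rw [Finset.sum_comm]
  refine Finset.sum_congr rfl fun h _ => ?_
  refine Fintype.sum_equiv (Equiv.subRight h) _ _ fun l => ?_
  have : -(l * k) = -(h * k) + -((l - h) * k) := by ring
  rw [Equiv.subRight_apply, this, AddChar.map_add_eq_mul]
  ring

theorem conj_stdAddChar (x : ZMod p) :
    conj (stdAddChar x : ℂ) = stdAddChar (-x) := by
  rw [AddChar.map_neg_eq_conj]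

theorem fft_transpose (A : Tensor3 m n p) (k : ZMod p) : fft (transpose A) k = (fft A k)ᴴ := by
  ext i j
  rw [conjTranspose_apply, fft_apply, fft_apply, star_sum]
  refine Fintype.sum_equiv (Equiv.neg _) _ _ fun l => ?_
  rw [star_mul', Equiv.neg_apply]
  simp [transpose, ← conj_stdAddChar]

theorem fft_identity (k : ZMod p) : fft (identity n p) k = 1 := by
  ext i j
  rw [fft_apply, Finset.sum_eq_single 0]
  · by_cases h : i = j <;> simp [identity, one_apply, h]
  · intro l _ hl
    simp [identity, hl]
  · simp

theorem fft_sub (A B : Tensor3 m n p) (k : ZMod p) : fft (A - B) k = fft A k - fft B k := by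
  ext i j
  simp [fft_apply, mul_sub]

theorem fft_smul (c : ℝ) (A : Tensor3 m n p) (k : ZMod p) :
    fft (c • A) k = (c : ℂ) • fft A k := by
  ext i j
  simp only [fft_apply, Matrix.smul_apply, smul_eq_mul, Finset.mul_sum, Pi.smul_apply,
    Complex.ofReal_mul]
  exact Finset.sum_congr rfl fun l _ => by ring

theorem fft_neg_index (A : Tensor3 m n p) (k : ZMod p) (i : Fin m) (j : Fin n) :
    fft A (-k) i j = conj (fft A k i j) := by
  simp [fft_apply, conj_stdAddChar]

/-- The real part in `sqrtFDiag` discards nothing: the prescribed slices are real and even in the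
frequency, so their inverse transform is already real. -/
theorem fft_sqrtFDiag (S : Tensor3 n n p) (k : ZMod p) :
    fft (sqrtFDiag S) k = Matrix.diagonal fun i => ((√((fft S k i i).re) : ℝ) : ℂ) := by
  set s : ZMod p → Matrix (Fin n) (Fin n) ℂ :=
    fun l => Matrix.diagonal fun i => ((√((fft S l i i).re) : ℝ) : ℂ) with hs
  have hneg : ∀ l, s (-l) = s l := fun l => by
    simp only [hs, fft_neg_index, Complex.conj_re]
  have hstar : ∀ l i j, conj (s l i j) = s l i j := fun l i j => by
    by_cases h : i = j <;> simp [hs, h]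
  have hreal : (fun k => (((ZMod.dft (N := p)).symm s k).map Complex.re).map
      ((↑) : ℝ → ℂ)) = (ZMod.dft (N := p)).symm s := by
    funext k
    ext i j
    rw [map_apply, map_apply, ← Complex.conj_eq_iff_re, invDFT_apply]
    simp only [Matrix.smul_apply, Matrix.sum_apply, smul_eq_mul, map_mul, map_inv₀, map_natCast,
      map_sum]
    congr 1
    refine Fintype.sum_equiv (Equiv.neg _) _ _ fun l => ?_
    rw [Equiv.neg_apply, conj_stdAddChar, hneg, hstar, neg_mul]
  have : fft (sqrtFDiag S) = s := by
    rw [fft]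
    simp only [sqrtFDiag]
    rw [hreal, LinearEquiv.apply_symm_apply]
  rw [this]

/-- The f-diagonal tensors whose diagonals are real and nonnegative in the Fourier domain. -/
structure IsPosFDiagonal (S : Tensor3 n n p) : Prop where
  diag : ∀ k i j, i ≠ j → fft S k i j = 0
  im : ∀ k i, (fft S k i i).im = 0
  re : ∀ k i, 0 ≤ (fft S k i i).re

theorem IsSkinnyTSVD.isPosFDiagonal {X : Tensor3 m n p} {U : Tensor3 m r p} {S : Tensor3 r r p}
    {V : Tensor3 n r p} (h : IsSkinnyTSVD X U S V) : IsPosFDiagonal S where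
  diag k i j hij := by
    rw [fft_apply]
    refine Finset.sum_eq_zero fun l _ => ?_
    rw [h.fdiag l hij]
    simp
  im := h.sv_real
  re := h.sv_nonneg

theorem IsPosFDiagonal.fft_eq {S : Tensor3 n n p} (h : IsPosFDiagonal S) (k : ZMod p) :
    fft S k = Matrix.diagonal fun i => (((fft S k i i).re : ℝ) : ℂ) := by
  ext i j
  by_cases hij : i = j
  · subst hij
    rw [diagonal_apply_eq]
    exact Complex.ext (by simp) (by simp [h.im])
  · rw [diagonal_apply_ne _ hij, h.diag k i j hij]

theorem IsPosFDiagonal.sqrtFDiag_tprod {S : Tensor3 n n p} (h : IsPosFDiagonal S) :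
    sqrtFDiag S ∗ₜ sqrtFDiag S = S := by
  refine fft_injective (funext fun k => ?_)
  rw [fft_tprod, fft_sqrtFDiag, diagonal_mul_diagonal, h.fft_eq k]
  congr 1
  funext i
  rw [← Complex.ofReal_mul, diagonal_apply_eq, Complex.ofReal_re, Real.mul_self_sqrt (h.re k i)]

theorem transpose_sqrtFDiag (S : Tensor3 n n p) : transpose (sqrtFDiag S) = sqrtFDiag S := by
  refine fft_injective (funext fun k => ?_)
  rw [fft_transpose, fft_sqrtFDiag, diagonal_conjTranspose]
  congr 1
  funext i
  simp

theorem bcirc_sqrtFDiag_transpose (S : Tensor3 n n p) :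
    (bcirc (sqrtFDiag S))ᵀ = bcirc (sqrtFDiag S) := by
  rw [← bcirc_transpose, transpose_sqrtFDiag]

theorem IsPosFDiagonal.bcirc_sqrtFDiag_mul {S : Tensor3 n n p} (h : IsPosFDiagonal S) :
    bcirc (sqrtFDiag S) * bcirc (sqrtFDiag S) = bcirc S := by
  rw [← bcirc_tprod, h.sqrtFDiag_tprod]

/-- `S - σI` again has a symmetric square root, which yields `S ⪰ σI` for the block circulant
matrices without diagonalizing them. -/
theorem IsPosFDiagonal.sub_smul_identity {S : Tensor3 n n p} (h : IsPosFDiagonal S) {σ : ℝ}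
    (hσ : ∀ k i, σ ≤ (fft S k i i).re) : IsPosFDiagonal (S - σ • identity n p) := by
  have key : ∀ k, fft (S - σ • identity n p) k = fft S k - (σ : ℂ) • 1 := fun k => by
    rw [fft_sub, fft_smul, fft_identity]
  refine ⟨fun k i j hij => ?_, fun k i => ?_, fun k i => ?_⟩
  · rw [key]
    simp [h.diag k i j hij, one_apply_ne hij]
  · rw [key]
    simp [h.im k i]
  · rw [key]
    simpa using hσ k i

/-- In the block circulant picture, an f-diagonal tensor is bounded below by the smallest of its
singular values. -/
theorem IsPosFDiagonal.le_vecNorm_mulVec {S : Tensor3 n n p} (h : IsPosFDiagonal S) {σ : ℝ}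
    (hσ : ∀ k i, σ ≤ (fft S k i i).re) (x : ZMod p × Fin n → ℝ) :
    σ * vecNorm x ≤ vecNorm (bcirc S *ᵥ x) := by
  have h1 := (h.sub_smul_identity hσ).bcirc_sqrtFDiag_mul
  have h2 := bcirc_sqrtFDiag_transpose (S - σ • identity n p)
  set T := bcirc (sqrtFDiag (S - σ • identity n p))
  rw [bcirc_sub, bcirc_smul, bcirc_identity] at h1
  -- `⟨x, S x⟩ = σ‖x‖² + ‖T x‖²`; Cauchy–Schwarz on the left then gives the bound.
  have h3 : x ⬝ᵥ (bcirc S *ᵥ x) = σ * vecNorm x ^ 2 + vecNorm (T *ᵥ x) ^ 2 := by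
    have e1 : bcirc S = σ • 1 + Tᵀ * T := by
      rw [h2, h1]
      abel
    have e2 : ∀ y : ZMod p × Fin n → ℝ, vecNorm y ^ 2 = y ⬝ᵥ y := fun y => by
      rw [vecNorm_sq]
      simp [dotProduct, sq]
    rw [e1, add_mulVec, dotProduct_add, smul_mulVec, one_mulVec, dotProduct_smul, ← mulVec_mulVec,
      dotProduct_mulVec, vecMul_transpose, e2, e2, smul_eq_mul]
  have h4 := (le_abs_self _).trans (abs_dotProduct_le x (bcirc S *ᵥ x))
  rcases (vecNorm_nonneg x).eq_or_lt with h0 | h0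
  · rw [← h0, mul_zero]
    exact vecNorm_nonneg _
  · refine le_of_mul_le_mul_left ?_ h0
    nlinarith [sq_nonneg (vecNorm (T *ᵥ x))]

end Fourier

/-! ### The diagonal of Σ⋆ and the singular values of X⋆. -/

section SingularValues

variable {m n p r : ℕ} [NeZero p] {X : Tensor3 m n p} {U : Tensor3 m r p} {S : Tensor3 r r p}
  {V : Tensor3 n r p}

theorem IsSkinnyTSVD.fft_eq (h : IsSkinnyTSVD X U S V) (k : ZMod p) :
    fft X k = fft U k * fft S k * (fft V k)ᴴ := by
  rw [h.eq_prod, fft_tprod, fft_tprod, fft_transpose]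

/-- A zero on the diagonal would bring the rank of that Fourier slice of X⋆ below `r`. -/
theorem IsSkinnyTSVD.re_pos (h : IsSkinnyTSVD X U S V) (hrank : ∀ k, multiRank X k = r)
    (k : ZMod p) (i : Fin r) : 0 < (fft S k i i).re := by
  refine lt_of_le_of_ne (h.sv_nonneg k i) fun h0 => ?_
  have h1 : r ≤ (fft S k).rank := by
    have h2 := hrank k
    rw [multiRank, h.fft_eq k] at h2
    exact h2.symm.le.trans <| (rank_mul_le_left _ _).trans (rank_mul_le_right _ _)
  rw [h.isPosFDiagonal.fft_eq k, rank_diagonal] at h1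
  have h2 : Fintype.card {j : Fin r // (((fft S k j j).re : ℝ) : ℂ) ≠ 0} < Fintype.card (Fin r) :=
    Fintype.card_subtype_lt (x := i) (by simp [← h0])
  rw [Fintype.card_fin] at h2
  omega

/-- The diagonal entries of the middle factor of a skinny t-SVD are singular values. -/
theorem IsSkinnyTSVD.exists_singularValues_eq (h : IsSkinnyTSVD X U S V) (k : ZMod p)
    (i : Fin r) :
    ∃ l : ℕ, (fft S k i i).re = (Matrix.toEuclideanLin (fft X k)).singularValues l := by
  classical
  set T := Matrix.toEuclideanLin (fft X k) with hT
  set g : ℝ := (fft S k i i).re with hg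
  have hU : (fft U k)ᴴ * fft U k = 1 := by
    rw [← fft_transpose, ← fft_tprod, h.left_orth, fft_identity]
  have hV : (fft V k)ᴴ * fft V k = 1 := by
    rw [← fft_transpose, ← fft_tprod, h.right_orth, fft_identity]
  set v : Fin n → ℂ := fft V k *ᵥ Pi.single i 1 with hv
  have hSh : (fft S k)ᴴ = fft S k := by
    rw [h.isPosFDiagonal.fft_eq k, diagonal_conjTranspose]
    congr 1
    funext j
    simp
  have hSe : fft S k *ᵥ Pi.single i 1 = (g : ℂ) • Pi.single i 1 := by
    rw [h.isPosFDiagonal.fft_eq k, diagonal_mulVec_single, ← Pi.single_smul, hg, smul_eq_mul]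
  -- The columns of `fft V k` are eigenvectors of `X̂ᴴ X̂`, with the squared diagonal entries as
  -- eigenvalues.
  have hXX : (fft X k)ᴴ * fft X k * fft V k = fft V k * (fft S k * fft S k) := by
    rw [h.fft_eq k]
    simp only [conjTranspose_mul, conjTranspose_conjTranspose, hSh, Matrix.mul_assoc, hV,
      Matrix.mul_one]
    rw [← Matrix.mul_assoc (fft U k)ᴴ, hU, Matrix.one_mul]
  have hmat : ((fft X k)ᴴ * fft X k) *ᵥ v = ((g ^ 2 : ℝ) : ℂ) • v := by
    rw [hv, mulVec_mulVec, hXX, ← mulVec_mulVec, ← mulVec_mulVec, hSe, mulVec_smul, hSe,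
      mulVec_smul, mulVec_smul, smul_smul]
    push_cast
    rw [sq]
  have hv0 : v ≠ 0 := fun h0 => by
    have : (fft V k)ᴴ *ᵥ v = Pi.single i 1 := by rw [hv, mulVec_mulVec, hV, one_mulVec]
    rw [h0, mulVec_zero] at this
    simpa using congrFun this i
  have heig : Module.End.HasEigenvalue (LinearMap.adjoint T ∘ₗ T) ((g ^ 2 : ℝ) : ℂ) := by
    refine Module.End.hasEigenvalue_of_hasEigenvector (x := WithLp.toLp 2 v) ⟨?_, ?_⟩
    · rw [Module.End.mem_eigenspace_iff, hT, ← Matrix.toEuclideanLin_conjTranspose_eq_adjoint,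
        LinearMap.comp_apply, Matrix.toLpLin_toLp, Matrix.toLpLin_toLp,
        toLin'_apply, toLin'_apply, mulVec_mulVec, hmat]
      rfl
    · intro h0
      exact hv0 (congrArg WithLp.ofLp h0)
  obtain ⟨l, hl⟩ := T.isSymmetric_adjoint_comp_self.exists_eigenvalues_eq rfl heig
  refine ⟨l, ?_⟩
  rw [T.singularValues_fin rfl l]
  have hl' : T.isSymmetric_adjoint_comp_self.eigenvalues rfl l = g ^ 2 := Complex.ofReal_injective hl
  rw [hl', Real.sqrt_sq (h.sv_nonneg k i)]

theorem IsSkinnyTSVD.sigmaMin_le (h : IsSkinnyTSVD X U S V) (hrank : ∀ k, multiRank X k = r)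
    (k : ZMod p) (i : Fin r) : sigmaMin X ≤ (fft S k i i).re := by
  obtain ⟨l, hl⟩ := h.exists_singularValues_eq k i
  exact csInf_le ⟨0, fun s hs => hs.1.le⟩ ⟨h.re_pos hrank k i, k, l, hl⟩

/-- The set of positive singular values is nonempty and finite, so its infimum is attained. -/
theorem IsSkinnyTSVD.sigmaMin_pos (h : IsSkinnyTSVD X U S V) (hrank : ∀ k, multiRank X k = r)
    (hr : 0 < r) : 0 < sigmaMin X := by
  set s := {s : ℝ | 0 < s ∧ ∃ (k : ZMod p) (i : ℕ),
    s = (Matrix.toEuclideanLin (fft X k)).singularValues i} with hs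
  have hne : s.Nonempty := by
    obtain ⟨l, hl⟩ := h.exists_singularValues_eq 0 ⟨0, hr⟩
    exact ⟨_, h.re_pos hrank 0 ⟨0, hr⟩, 0, l, hl⟩
  have hfin : s.Finite := by
    refine (Set.finite_iUnion fun k : ZMod p =>
      ((Matrix.toEuclideanLin (fft X k)).singularValues.finite_range)).subset ?_
    rintro x ⟨_, k, i, rfl⟩
    exact Set.mem_iUnion.2 ⟨k, i, rfl⟩
  exact (hne.csInf_mem hfin).1

end SingularValues

end Tensor3

end

noncomputable section

namespace Matrix

open scoped Matrix.Norms.L2Operator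

/-! ### Derivative of the alignment objective. -/

section FirstOrder

variable {ι κ ρ : Type*} [Fintype ι] [Fintype κ] [Fintype ρ]
variable [DecidableEq ι] [DecidableEq κ] [DecidableEq ρ]

theorem hasDerivAt_frob_sq {A : ℝ → Matrix ι κ ℝ} {A' : Matrix ι κ ℝ} {s : ℝ}
    (h : ∀ i j, HasDerivAt (fun s => A s i j) (A' i j) s) :
    HasDerivAt (fun s => frob (A s) ^ 2) (2 * trace ((A s)ᵀ * A')) s := by
  simp only [frob_sq]
  have h1 := HasDerivAt.fun_sum (u := Finset.univ) fun i _ =>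
    HasDerivAt.fun_sum (u := Finset.univ) fun j _ => (h i j).fun_pow 2
  refine h1.congr_deriv ?_
  rw [trace, Finset.mul_sum, Finset.sum_comm]
  refine Finset.sum_congr rfl fun j _ => ?_
  rw [diag_apply, mul_apply, Finset.mul_sum]
  refine Finset.sum_congr rfl fun i _ => ?_
  rw [transpose_apply]
  push_cast
  ring

theorem hasDerivAt_inverse_one_add_smul (M : Matrix ρ ρ ℝ) :
    HasDerivAt (fun s : ℝ => Ring.inverse (1 + s • M)) (-M) 0 := by
  have : CompleteSpace (Matrix ρ ρ ℝ) := FiniteDimensional.complete ℝ _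
  have h1 : HasDerivAt (fun s : ℝ => 1 + s • M) M 0 := by
    simpa using ((hasDerivAt_id (0 : ℝ)).smul_const M).const_add 1
  have h2 : HasFDerivAt Ring.inverse
      (-ContinuousLinearMap.mulLeftRight ℝ (Matrix ρ ρ ℝ) ↑(1 : (Matrix ρ ρ ℝ)ˣ)⁻¹
        ↑(1 : (Matrix ρ ρ ℝ)ˣ)⁻¹) (1 + (0 : ℝ) • M) := by
    have := hasFDerivAt_ringInverse (𝕜 := ℝ) (1 : (Matrix ρ ρ ℝ)ˣ)
    rwa [zero_smul, add_zero]
  have h3 := h2.comp_hasDerivAt (0 : ℝ) h1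
  refine h3.congr_deriv ?_
  simp

/-- First order condition for the alignment problem. -/
theorem trace_eq_of_isLocalMin {DL A : Matrix ι ρ ℝ} {C E : Matrix κ ρ ℝ} {M D : Matrix ρ ρ ℝ}
    (h : IsLocalMin (fun s : ℝ => frob (DL + s • A) ^ 2 +
      frob (C * (Ring.inverse (1 + s • M))ᵀ * D - E) ^ 2) 0) :
    trace (DLᵀ * A) = trace ((C * D - E)ᵀ * (C * Mᵀ * D)) := by
  have h1 : HasDerivAt (fun s : ℝ => frob (DL + s • A) ^ 2)
      (2 * trace ((DL + (0 : ℝ) • A)ᵀ * A)) 0 := by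
    refine hasDerivAt_frob_sq (A := fun s => DL + s • A) fun i j => ?_
    simpa using ((hasDerivAt_id (0 : ℝ)).mul_const (A i j)).const_add (DL i j)
  have h2 : HasDerivAt (fun s : ℝ => frob (C * (Ring.inverse (1 + s • M))ᵀ * D - E) ^ 2)
      (2 * trace ((C * (Ring.inverse (1 + (0 : ℝ) • M))ᵀ * D - E)ᵀ * (C * (-M)ᵀ * D))) 0 := by
    refine hasDerivAt_frob_sq (A := fun s => C * (Ring.inverse (1 + s • M))ᵀ * D - E)
      fun i j => ?_
    let l : Matrix ρ ρ ℝ →ₗ[ℝ] ℝ :=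
      { toFun := fun X => (C * Xᵀ * D) i j
        map_add' := fun X Y => by
          rw [transpose_add, Matrix.mul_add, Matrix.add_mul, add_apply]
        map_smul' := fun c X => by
          rw [transpose_smul, Matrix.mul_smul, Matrix.smul_mul, smul_apply, RingHom.id_apply] }
    have h3 := l.toContinuousLinearMap.hasFDerivAt.comp_hasDerivAt (0 : ℝ)
      (hasDerivAt_inverse_one_add_smul M)
    exact h3.sub_const (E i j)
  have h3 := h.hasDerivAt_eq_zero (h1.add h2)
  simp only [zero_smul, add_zero, Ring.inverse_one, transpose_one, Matrix.mul_one, transpose_neg,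
    Matrix.mul_neg, Matrix.neg_mul, trace_neg] at h3
  linarith

end FirstOrder

end Matrix

namespace Tensor3

open Matrix

open scoped Matrix.Norms.L2Operator

/-! ### Aligned errors and the optimality condition. -/

section Alignment

variable {m n p r : ℕ} [NeZero p] {U L : Tensor3 m r p} {V R : Tensor3 n r p}
  {S Q : Tensor3 r r p} {σ : ℝ}

theorem IsPosFDiagonal.isUnit_bcirc (h : IsPosFDiagonal S) (hσ : 0 < σ)
    (hS : ∀ k i, σ ≤ (fft S k i i).re) : IsUnit (bcirc S) := by
  rw [← mulVec_injective_iff_isUnit, ← coe_mulVecLin, ← LinearMap.ker_eq_bot,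
    LinearMap.ker_eq_bot']
  intro x hx
  have h1 := h.le_vecNorm_mulVec hS x
  rw [← mulVecLin_apply, hx] at h1
  have h2 : vecNorm x = 0 := le_antisymm (by
    have h0 : vecNorm (0 : ZMod p × Fin r → ℝ) = 0 := norm_zero
    rw [h0] at h1
    exact nonpos_of_mul_nonpos_right h1 hσ) (vecNorm_nonneg _)
  exact congrArg WithLp.ofLp (norm_eq_zero.1 h2)

theorem IsPosFDiagonal.isUnit_bcirc_sqrt (h : IsPosFDiagonal S) (hu : IsUnit (bcirc S)) :
    IsUnit (bcirc (sqrtFDiag S)) := by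
  rw [← h.bcirc_sqrtFDiag_mul, isUnit_iff_isUnit_det, det_mul] at hu
  exact (isUnit_iff_isUnit_det _).2 (isUnit_of_mul_isUnit_left hu)

theorem IsPosFDiagonal.bcirc_transpose_eq (h : IsPosFDiagonal S) : (bcirc S)ᵀ = bcirc S := by
  rw [← h.bcirc_sqrtFDiag_mul, transpose_mul, bcirc_sqrtFDiag_transpose]

theorem IsPosFDiagonal.norm_inv_le (h : IsPosFDiagonal S) (hσ : 0 < σ)
    (hS : ∀ k i, σ ≤ (fft S k i i).re) : ‖(bcirc S)⁻¹‖ ≤ σ⁻¹ := by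
  have hu := (isUnit_iff_isUnit_det _).1 (h.isUnit_bcirc hσ hS)
  refine l2_opNorm_le _ (inv_nonneg.2 hσ.le) fun x => ?_
  have h1 := h.le_vecNorm_mulVec hS ((bcirc S)⁻¹ *ᵥ x)
  rw [mulVec_mulVec, mul_nonsing_inv _ hu, one_mulVec] at h1
  rwa [← div_eq_inv_mul, le_div_iff₀' hσ]

/-- The aligned and rescaled factor is a perturbation of the singular tensor. -/
theorem IsPosFDiagonal.bcirc_mul_eq (h : IsPosFDiagonal S) (hu : IsUnit (bcirc S))
    (U L : Tensor3 m r p) (Q : Tensor3 r r p) :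
    bcirc L * bcirc Q = (bcirc U + bcirc (leftError U S L Q) * (bcirc S)⁻¹) *
      bcirc (sqrtFDiag S) := by
  have hH := (isUnit_iff_isUnit_det _).1 (h.isUnit_bcirc_sqrt hu)
  have h1 : (bcirc S)⁻¹ * bcirc (sqrtFDiag S) = (bcirc (sqrtFDiag S))⁻¹ := by
    rw [← h.bcirc_sqrtFDiag_mul, Matrix.mul_inv_rev, Matrix.mul_assoc, nonsing_inv_mul _ hH,
      Matrix.mul_one]
  rw [Matrix.add_mul, Matrix.mul_assoc, h1, leftError, bcirc_tprod, Matrix.mul_assoc,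
    mul_nonsing_inv _ hH, Matrix.mul_one, bcirc_sub, bcirc_tprod, bcirc_tprod]
  abel

theorem IsPosFDiagonal.bcirc_leftError (h : IsPosFDiagonal S) (U L : Tensor3 m r p)
    (Q : Tensor3 r r p) : bcirc (leftError U S L Q) =
      bcirc L * bcirc Q * bcirc (sqrtFDiag S) - bcirc U * bcirc S := by
  rw [leftError, bcirc_tprod, bcirc_sub, bcirc_tprod, bcirc_tprod, Matrix.sub_mul,
    Matrix.mul_assoc (bcirc U), h.bcirc_sqrtFDiag_mul]

theorem rightError_eq (V R : Tensor3 n r p) (S Q : Tensor3 r r p) :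
    rightError V S R Q = leftError V S R (transpose (inv Q)) := rfl

theorem alignError_nonneg : 0 ≤ alignError U S V L R Q := Real.sqrt_nonneg _

theorem alignError_sq : p * alignError U S V L R Q ^ 2 =
    frob (bcirc (leftError U S L Q)) ^ 2 +
      frob (bcirc (leftError V S R (transpose (inv Q)))) ^ 2 := by
  rw [alignError, Real.sq_sqrt (by positivity), mul_add, ← frob_bcirc_sq, ← frob_bcirc_sq,
    rightError_eq]

/-- The `√p` of the tensor norm disappears here, and later bounds are stated for matrices only. -/
theorem alignError_le_iff {c : ℝ} (hc : 0 ≤ c) :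
    alignError U S V L R Q ≤ c / √p ↔ frob (bcirc (leftError U S L Q)) ^ 2 +
      frob (bcirc (leftError V S R (transpose (inv Q)))) ^ 2 ≤ c ^ 2 := by
  have hp : (0 : ℝ) < p := Nat.cast_pos.2 (NeZero.pos p)
  rw [← alignError_sq, ← sq_le_sq₀ alignError_nonneg (by positivity), div_pow, Real.sq_sqrt hp.le,
    le_div_iff₀' hp]

/-- First order condition satisfied by an optimal alignment. -/
theorem IsOptimalAlignment.transpose_mul_eq (h : IsOptimalAlignment U S V L R Q)
    (hS : IsPosFDiagonal S) (hu : IsUnit (bcirc S)) :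
    (bcirc U + bcirc (leftError U S L Q) * (bcirc S)⁻¹)ᵀ * bcirc (leftError U S L Q) =
      (bcirc (leftError V S R (transpose (inv Q))))ᵀ *
        (bcirc V + bcirc (leftError V S R (transpose (inv Q))) * (bcirc S)⁻¹) := by
  have hHu := hS.isUnit_bcirc_sqrt hu
  have hHi := isInvertible_of_isUnit hHu
  have hSi := isInvertible_of_isUnit hu
  have hSinv : (bcirc S)⁻¹ = bcirc (inv S) := inv_eq_right_inv (bcirc_mul_bcirc_inv hSi)
  have hL := hS.bcirc_mul_eq hu U L Q
  have hR := hS.bcirc_mul_eq hu V R (transpose (inv Q))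
  have hDR := hS.bcirc_leftError V R (transpose (inv Q))
  have hHt := bcirc_sqrtFDiag_transpose S
  set H := sqrtFDiag S
  set DL := leftError U S L Q
  set P := transpose (inv Q) with hP
  set DR := leftError V S R P
  rw [hSinv] at hL hR ⊢
  -- Only tensors are admissible alignments, so the direction of variation must be block circulant;
  -- this requires the two perturbed factors to come from tensors.
  obtain ⟨Z, hZ⟩ : ∃ Z : Tensor3 m r p, bcirc U + bcirc DL * bcirc (inv S) = bcirc Z :=
    ⟨U + DL ∗ₜ inv S, by rw [bcirc_add, bcirc_tprod]⟩
  obtain ⟨W, hW⟩ : ∃ W : Tensor3 n r p, bcirc V + bcirc DR * bcirc (inv S) = bcirc W :=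
    ⟨V + DR ∗ₜ inv S, by rw [bcirc_add, bcirc_tprod]⟩
  rw [hZ] at hL ⊢
  rw [hW] at hR ⊢
  rw [← bcirc_transpose, ← bcirc_transpose]
  set K := transpose Z ∗ₜ DL - transpose DR ∗ₜ W with hK
  -- The alignment varies along `Q (1 + sM)`. For this `M` the stationarity condition reads `‖K‖_F²
  -- = 0`, where `K` is the defect of the claimed identity.
  set M := inv H ∗ₜ K ∗ₜ inv H with hM
  have hHM : bcirc H * bcirc M * bcirc H = bcirc K := by
    rw [hM, bcirc_tprod, bcirc_tprod, ← Matrix.mul_assoc, ← Matrix.mul_assoc,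
      bcirc_mul_bcirc_inv hHi, Matrix.one_mul, Matrix.mul_assoc, bcirc_inv_mul_bcirc hHi,
      Matrix.mul_one]
  have hHM' : bcirc H * (bcirc M)ᵀ * bcirc H = (bcirc K)ᵀ := by
    rw [← hHM, transpose_mul, transpose_mul, hHt, Matrix.mul_assoc]
  have hmin : IsLocalMin (fun s : ℝ => frob (bcirc DL + s • (bcirc L * bcirc Q * bcirc M *
      bcirc H)) ^ 2 + frob (bcirc R * bcirc P * (Ring.inverse (1 + s • bcirc M))ᵀ * bcirc H -
        bcirc V * bcirc S) ^ 2) 0 := by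
    have hcont : Filter.Tendsto (fun s : ℝ => 1 + s • bcirc M) (nhds 0) (nhds 1) := by
      have : Continuous fun s : ℝ => 1 + s • bcirc M := by fun_prop
      simpa using this.tendsto 0
    have : CompleteSpace (Matrix (ZMod p × Fin r) (ZMod p × Fin r) ℝ) :=
      FiniteDimensional.complete ℝ _
    have hunit : ∀ᶠ s : ℝ in nhds 0, IsUnit (1 + s • bcirc M) :=
      hcont.eventually (Units.isOpen.mem_nhds isUnit_one)
    have hval : ∀ s : ℝ, IsUnit (1 + s • bcirc M) →
        IsInvertible (Q ∗ₜ (identity r p + s • M)) ∧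
        p * alignError U S V L R (Q ∗ₜ (identity r p + s • M)) ^ 2 =
        frob (bcirc DL + s • (bcirc L * bcirc Q * bcirc M * bcirc H)) ^ 2 +
          frob (bcirc R * bcirc P * (Ring.inverse (1 + s • bcirc M))ᵀ * bcirc H -
            bcirc V * bcirc S) ^ 2 := by
      intro s hs
      have hb : bcirc (Q ∗ₜ (identity r p + s • M)) = bcirc Q * (1 + s • bcirc M) := by
        rw [bcirc_tprod, bcirc_add, bcirc_smul, bcirc_identity]
      have hQu : IsUnit (bcirc Q) :=
        ⟨⟨_, _, bcirc_mul_bcirc_inv h.1, bcirc_inv_mul_bcirc h.1⟩, rfl⟩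
      have hQs : IsInvertible (Q ∗ₜ (identity r p + s • M)) :=
        isInvertible_of_isUnit (hb ▸ hQu.mul hs)
      have hinv : bcirc (inv (Q ∗ₜ (identity r p + s • M))) =
          Ring.inverse (1 + s • bcirc M) * bcirc (inv Q) := by
        have e1 := bcirc_inv_mul_bcirc hQs
        rw [hb] at e1
        calc bcirc (inv (Q ∗ₜ (identity r p + s • M)))
            = bcirc (inv (Q ∗ₜ (identity r p + s • M))) * (bcirc Q *
              ((1 + s • bcirc M) * Ring.inverse (1 + s • bcirc M)) * bcirc (inv Q)) := by
              rw [Ring.mul_inverse_cancel _ hs, Matrix.mul_one, bcirc_mul_bcirc_inv h.1,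
                Matrix.mul_one]
          _ = bcirc (inv (Q ∗ₜ (identity r p + s • M))) * (bcirc Q * (1 + s • bcirc M)) *
              (Ring.inverse (1 + s • bcirc M) * bcirc (inv Q)) := by
              simp only [Matrix.mul_assoc]
          _ = _ := by rw [e1, Matrix.one_mul]
      refine ⟨hQs, ?_⟩
      rw [alignError_sq, hS.bcirc_leftError, hS.bcirc_leftError, hb, bcirc_transpose, hinv,
        transpose_mul, hP, bcirc_transpose, hS.bcirc_leftError U L Q]
      congr 3
      · rw [Matrix.mul_add, Matrix.mul_one, Matrix.mul_add, Matrix.add_mul, Matrix.mul_smul,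
          Matrix.mul_smul, Matrix.smul_mul, Matrix.mul_assoc (bcirc L)]
        simp only [Matrix.mul_assoc]
        abel
      · simp only [Matrix.mul_assoc]
        rfl
    have h0 := (hval 0 (by simp)).2
    filter_upwards [hunit] with s hs
    rw [← h0, ← (hval s hs).2]
    have hQ0 : Q ∗ₜ (identity r p + (0 : ℝ) • M) = Q := bcirc_injective (by
      rw [bcirc_tprod, bcirc_add, bcirc_smul, bcirc_identity, zero_smul, add_zero, Matrix.mul_one])
    rw [hQ0]
    exact mul_le_mul_of_nonneg_left
      (pow_le_pow_left₀ alignError_nonneg (h.2 _ (hval s hs).1) 2) (Nat.cast_nonneg p)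
  have htr := trace_eq_of_isLocalMin hmin
  rw [← hDR, hL, hR] at htr
  have e1 : bcirc Z * bcirc H * bcirc M * bcirc H = bcirc Z * bcirc K := by
    rw [← hHM]
    simp only [Matrix.mul_assoc]
  have e2 : bcirc W * bcirc H * (bcirc M)ᵀ * bcirc H = bcirc W * (bcirc K)ᵀ := by
    rw [← hHM']
    simp only [Matrix.mul_assoc]
  rw [e1, e2] at htr
  have h0 : frob (bcirc K) ^ 2 = 0 := by
    have e3 : (bcirc K)ᵀ = (bcirc DL)ᵀ * bcirc Z - (bcirc W)ᵀ * bcirc DR := by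
      rw [hK, bcirc_sub, bcirc_tprod, bcirc_tprod, transpose_sub, transpose_mul, transpose_mul,
        bcirc_transpose, bcirc_transpose, transpose_transpose, transpose_transpose]
    have e4 : trace ((bcirc DR)ᵀ * (bcirc W * (bcirc K)ᵀ)) =
        trace ((bcirc W)ᵀ * bcirc DR * bcirc K) := by
      rw [← trace_transpose, transpose_mul, transpose_mul, transpose_transpose,
        transpose_transpose, Matrix.mul_assoc, trace_mul_comm]
    rw [frob_sq_eq_trace]
    conv_lhs => rw [e3]
    rw [Matrix.sub_mul, trace_sub, Matrix.mul_assoc, htr, e4, sub_self]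
  have hK0 : bcirc K = 0 := frob_eq_zero (pow_eq_zero_iff two_ne_zero |>.1 h0)
  rw [hK, bcirc_sub, bcirc_tprod, bcirc_tprod] at hK0
  exact sub_eq_zero.1 hK0

end Alignment

end Tensor3

end

noncomputable section

namespace Tensor3

open Matrix

/-! ### Existence of optimal alignments. -/

section Existence

variable {m n q p r : ℕ}

/-- A tensor as a vector of a Euclidean space. -/
def toEuclidean [NeZero p] :
    Tensor3 m n p →ₗ[ℝ] EuclideanSpace ℝ (ZMod p × Fin m × Fin n) where
  toFun A := WithLp.toLp 2 fun x => A x.1 x.2.1 x.2.2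
  map_add' _ _ := rfl
  map_smul' _ _ := rfl

theorem transpose_transpose (A : Tensor3 m n p) : transpose (transpose A) = A :=
  bcirc_injective (by rw [bcirc_transpose, bcirc_transpose, Matrix.transpose_transpose])

variable [NeZero p]

theorem toEuclidean_injective :
    Function.Injective (toEuclidean : Tensor3 m n p →ₗ[ℝ] _) := by
  intro A B h
  funext k
  ext i j
  exact congrFun (congrArg WithLp.ofLp h) (k, i, j)

theorem frobNorm_eq_norm (A : Tensor3 m n p) : frobNorm A = ‖toEuclidean A‖ := by
  rw [EuclideanSpace.norm_eq, frobNorm, Fintype.sum_prod_type]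
  simp only [Fintype.sum_prod_type, Real.norm_eq_abs, sq_abs]
  rfl

/-- The linear map `Q ↦ L * Q * H`. -/
def mulLeftRight (L : Tensor3 m r p) (H : Tensor3 r r p) : Tensor3 r r p →ₗ[ℝ] Tensor3 m r p where
  toFun Q := L ∗ₜ Q ∗ₜ H
  map_add' A B := bcirc_injective (by
    simp only [bcirc_tprod, bcirc_add, Matrix.mul_add, Matrix.add_mul])
  map_smul' c A := bcirc_injective (by
    simp only [bcirc_tprod, bcirc_smul, Matrix.mul_smul, Matrix.smul_mul, RingHom.id_apply])

/-- Transposition as a linear map. -/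
def transposeLinear : Tensor3 m n p →ₗ[ℝ] Tensor3 n m p where
  toFun := transpose
  map_add' _ _ := rfl
  map_smul' _ _ := rfl

theorem mulLeftRight_injective {L : Tensor3 m r p} {H : Tensor3 r r p}
    (hL : IsUnit ((bcirc L)ᵀ * bcirc L)) (hH : IsUnit (bcirc H)) :
    Function.Injective (mulLeftRight L H) := by
  intro A B h
  have h1 : bcirc L * bcirc A * bcirc H = bcirc L * bcirc B * bcirc H := by
    rw [← bcirc_tprod, ← bcirc_tprod, ← bcirc_tprod, ← bcirc_tprod]
    exact congrArg bcirc h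
  have h2 : (bcirc L)ᵀ * bcirc L * bcirc A = (bcirc L)ᵀ * bcirc L * bcirc B := by
    refine hH.mul_right_cancel ?_
    rw [Matrix.mul_assoc _ _ (bcirc A), Matrix.mul_assoc _ _ (bcirc B),
      Matrix.mul_assoc (bcirc L)ᵀ, Matrix.mul_assoc (bcirc L)ᵀ, h1]
  exact bcirc_injective (hL.mul_left_cancel h2)

theorem leftError_eq (U L : Tensor3 m r p) (S Q : Tensor3 r r p) :
    leftError U S L Q = mulLeftRight L (sqrtFDiag S) Q -
      U ∗ₜ sqrtFDiag S ∗ₜ sqrtFDiag S := by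
  refine bcirc_injective ?_
  rw [leftError, bcirc_tprod, bcirc_sub, Matrix.sub_mul, ← bcirc_tprod, ← bcirc_tprod, bcirc_sub]
  rfl

theorem continuous_tprod :
    Continuous fun x : Tensor3 m n p × Tensor3 n q p => x.1 ∗ₜ x.2 := by
  refine continuous_pi fun k => continuous_matrix fun i j => ?_
  simp only [tprod, of_apply]
  refine continuous_finsetSum _ fun s _ => continuous_finsetSum _ fun l _ => ?_
  have h1 : Continuous fun x : Tensor3 m n p × Tensor3 n q p => x.1 l i s :=
    ((continuous_apply l).comp continuous_fst).matrix_elem i s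
  have h2 : Continuous fun x : Tensor3 m n p × Tensor3 n q p => x.2 (k - l) s j :=
    ((continuous_apply (k - l)).comp continuous_snd).matrix_elem s j
  exact h1.mul h2

/-- The squared alignment error as a function of an invertible tensor and its inverse. -/
theorem alignError_sq_eq (U L : Tensor3 m r p) (V R : Tensor3 n r p) (S Q : Tensor3 r r p) :
    alignError U S V L R Q ^ 2 =
      ‖toEuclidean (leftError U S L Q)‖ ^ 2 +
        ‖toEuclidean (leftError V S R (transpose (inv Q)))‖ ^ 2 := by
  rw [alignError, Real.sq_sqrt (by positivity), frobNorm_eq_norm, frobNorm_eq_norm, rightError_eq]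

/-- Optimal alignments exist as soon as both factors have full column rank. -/
theorem exists_isOptimalAlignment {U L : Tensor3 m r p} {V R : Tensor3 n r p} {S : Tensor3 r r p}
    (hL : IsUnit ((bcirc L)ᵀ * bcirc L)) (hR : IsUnit ((bcirc R)ᵀ * bcirc R))
    (hH : IsUnit (bcirc (sqrtFDiag S))) : ∃ Q, IsOptimalAlignment U S V L R Q := by
  let E := Tensor3 r r p
  set H := sqrtFDiag S with hHdef
  let a : E →ₗ[ℝ] EuclideanSpace ℝ (ZMod p × Fin m × Fin r) := toEuclidean ∘ₗ mulLeftRight L H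
  let b : E →ₗ[ℝ] EuclideanSpace ℝ (ZMod p × Fin n × Fin r) :=
    toEuclidean ∘ₗ mulLeftRight R H ∘ₗ transposeLinear
  have ha : Function.Injective a :=
    toEuclidean_injective.comp (mulLeftRight_injective hL hH)
  have hb : Function.Injective b := by
    refine toEuclidean_injective.comp ((mulLeftRight_injective hR hH).comp fun A B hAB => ?_)
    rw [← transpose_transpose A, ← transpose_transpose B]
    exact congrArg transpose hAB
  let u : EuclideanSpace ℝ (ZMod p × Fin m × Fin r) := toEuclidean (U ∗ₜ H ∗ₜ H)
  let v : EuclideanSpace ℝ (ZMod p × Fin n × Fin r) := toEuclidean (V ∗ₜ H ∗ₜ H)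
  let f : E × E → ℝ := fun x => ‖a x.1 - u‖ ^ 2 + ‖b x.2 - v‖ ^ 2
  have hac : Continuous a := LinearMap.continuous_of_finiteDimensional a
  have hbc : Continuous b := LinearMap.continuous_of_finiteDimensional b
  have hfc : Continuous f := by fun_prop
  have hfe : ∀ Q : E, alignError U S V L R Q ^ 2 = f (Q, inv Q) := fun Q => by
    rw [alignError_sq_eq, leftError_eq, leftError_eq, map_sub, map_sub]
    rfl
  -- Minimizing over pairs made of a tensor and its inverse keeps the constraint closed, so a limit
  -- cannot become singular.
  let K : Set (E × E) := {x | x.1 ∗ₜ x.2 = identity r p ∧ f x ≤ f (identity r p, identity r p)}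
  have hKc : IsClosed K :=
    (isClosed_eq continuous_tprod continuous_const).inter
      (isClosed_le hfc continuous_const)
  set c := √(f (identity r p, identity r p)) with hc
  -- A bounded objective bounds the images of both components under injective linear maps, which are
  -- closed embeddings in finite dimension.
  have hKsub : K ⊆ (a ⁻¹' Metric.closedBall u c) ×ˢ (b ⁻¹' Metric.closedBall v c) := by
    intro x hx
    constructor
    · rw [Set.mem_preimage, mem_closedBall_iff_norm]
      refine Real.le_sqrt_of_sq_le (le_trans ?_ hx.2)
      exact le_add_of_nonneg_right (sq_nonneg _)
    · rw [Set.mem_preimage, mem_closedBall_iff_norm]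
      refine Real.le_sqrt_of_sq_le (le_trans ?_ hx.2)
      exact le_add_of_nonneg_left (sq_nonneg _)
  have hK : IsCompact K := by
    refine IsCompact.of_isClosed_subset (IsCompact.prod ?_ ?_) hKc hKsub
    · exact (LinearMap.isClosedEmbedding_of_injective (LinearMap.ker_eq_bot.2 ha)).isCompact_preimage
        (isCompact_closedBall _ _)
    · exact (LinearMap.isClosedEmbedding_of_injective (LinearMap.ker_eq_bot.2 hb)).isCompact_preimage
        (isCompact_closedBall _ _)
  have hI : (identity r p, identity r p) ∈ K := by
    refine ⟨bcirc_injective ?_, le_rfl⟩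
    rw [bcirc_tprod, bcirc_identity, Matrix.mul_one]
  obtain ⟨x, hxK, hx⟩ := hK.exists_isMinOn ⟨_, hI⟩ hfc.continuousOn
  have hinv : IsInverse x.1 x.2 := isInverse_iff.2 (by rw [← bcirc_tprod, hxK.1, bcirc_identity])
  refine ⟨x.1, ⟨x.2, hinv⟩, fun P hP => ?_⟩
  rw [← sq_le_sq₀ alignError_nonneg alignError_nonneg, hfe, hfe, hinv.bcirc_inv_eq]
  -- Outside `K` the error is larger than at the identity, hence at least the minimum.
  by_cases hPK : (P, inv P) ∈ K
  · exact hx hPK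
  · refine hxK.2.trans (le_of_not_ge fun hle => hPK ⟨bcirc_injective ?_, hle⟩)
    rw [bcirc_tprod, bcirc_mul_bcirc_inv hP, bcirc_identity]

theorem IsOptimalAlignment.factorDist_eq {U L : Tensor3 m r p} {V R : Tensor3 n r p}
    {S Q : Tensor3 r r p} (h : IsOptimalAlignment U S V L R Q) :
    factorDist U S V L R = alignError U S V L R Q := by
  refine le_antisymm (ciInf_le ⟨0, ?_⟩ (⟨Q, h.1⟩ : {Q // IsInvertible Q})) ?_
  · rintro _ ⟨P, rfl⟩
    exact alignError_nonneg
  · have : Nonempty {Q : Tensor3 r r p // IsInvertible Q} := ⟨⟨Q, h.1⟩⟩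
    exact le_ciInf fun P => h.2 P P.2

theorem exists_alignError_lt {U L : Tensor3 m r p} {V R : Tensor3 n r p}
    {S : Tensor3 r r p} {c : ℝ} (h : factorDist U S V L R < c) :
    ∃ Q, IsInvertible Q ∧ alignError U S V L R Q < c := by
  have : Nonempty {Q : Tensor3 r r p // IsInvertible Q} := ⟨⟨identity r p, identity r p,
    isInverse_iff.2 (by rw [bcirc_identity, Matrix.mul_one])⟩⟩
  obtain ⟨Q, hQ⟩ := exists_lt_of_ciInf_lt h
  exact ⟨Q, Q.2, hQ⟩

end Existence

end Tensor3

end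

noncomputable section

namespace Tensor3

open Matrix

open scoped Matrix.Norms.L2Operator

/-! ### One step of the algorithm in the block circulant picture. -/

section LocalStep

variable {m n p r : ℕ} [NeZero p]

/-- The properties of the incoherent ground truth `U * S * Vᵀ` that the local analysis uses, in
the block circulant picture. -/
structure IsSpectralModel (U : Tensor3 m r p) (S : Tensor3 r r p) (V : Tensor3 n r p)
    (σ c d : ℝ) : Prop where
  pos : IsPosFDiagonal S
  isUnit : IsUnit (bcirc S)
  sigma_pos : 0 < σ
  norm_inv : ‖(bcirc S)⁻¹‖ ≤ σ⁻¹
  orth_left : (bcirc U)ᵀ * bcirc U = 1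
  orth_right : (bcirc V)ᵀ * bcirc V = 1
  nonneg_left : 0 ≤ c
  nonneg_right : 0 ≤ d
  row_left : ∀ x, vecNorm (bcirc U x) ≤ c
  row_right : ∀ x, vecNorm (bcirc V x) ≤ d

/-- The aligned factors `L * Q` and `R * P`, with `P = Q^{-⊤}`, are close to the true factors. -/
structure IsNearAlignment (U : Tensor3 m r p) (S : Tensor3 r r p) (V : Tensor3 n r p)
    (c d s : ℝ) (L : Tensor3 m r p) (R : Tensor3 n r p) (Q P : Tensor3 r r p) : Prop where
  inv : bcirc Q * (bcirc P)ᵀ = 1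
  frob_le : frob (bcirc (leftError U S L Q)) ^ 2 + frob (bcirc (leftError V S R P)) ^ 2 ≤
    (0.02 * s) ^ 2
  row_left : ∀ x, vecNorm (bcirc (leftError U S L Q) x) ≤ c * s
  row_right : ∀ x, vecNorm (bcirc (leftError V S R P) x) ≤ d * s

variable {U L : Tensor3 m r p} {V R : Tensor3 n r p} {S Q P : Tensor3 r r p} {σ c d s : ℝ}

/-- The setting is symmetric under exchanging the two factors, so each estimate is proved on the
left and transferred. -/
theorem IsSpectralModel.symm (h : IsSpectralModel U S V σ c d) : IsSpectralModel V S U σ d c :=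
  ⟨h.pos, h.isUnit, h.sigma_pos, h.norm_inv, h.orth_right, h.orth_left, h.nonneg_right,
    h.nonneg_left, h.row_right, h.row_left⟩

theorem mul_transpose_symm (h : bcirc Q * (bcirc P)ᵀ = 1) : bcirc P * (bcirc Q)ᵀ = 1 := by
  rw [← Matrix.transpose_one, ← h, transpose_mul, Matrix.transpose_transpose]

theorem IsNearAlignment.symm (h : IsNearAlignment U S V c d s L R Q P) :
    IsNearAlignment V S U d c s R L P Q :=
  ⟨mul_transpose_symm h.inv, (add_comm _ _).trans_le h.frob_le, h.row_right, h.row_left⟩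

theorem IsSpectralModel.norm_mul_inv_le (h : IsSpectralModel U S V σ c d) {D : Tensor3 m r p}
    {e : ℝ} (he : frob (bcirc D) ≤ e * σ) : ‖bcirc D * (bcirc S)⁻¹‖ ≤ e := by
  refine (l2_opNorm_mul _ _).trans ((mul_le_mul ((l2_opNorm_le_frob _).trans he) h.norm_inv
    (norm_nonneg _) ((frob_nonneg _).trans he)).trans_eq ?_)
  rw [mul_assoc, mul_inv_cancel₀ h.sigma_pos.ne', mul_one]

theorem IsSpectralModel.vecNorm_row_le (h : IsSpectralModel U S V σ c d) (hs : s ≤ σ)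
    {D : Tensor3 m r p} {x} (he : vecNorm (bcirc D x) ≤ c * s) :
    vecNorm ((bcirc D * (bcirc S)⁻¹) x) ≤ c := by
  rw [mul_row]
  refine (vecNorm_vecMul_le _ _).trans ((mul_le_mul
    (he.trans (mul_le_mul_of_nonneg_left hs h.nonneg_left)) h.norm_inv
    (norm_nonneg _) (mul_nonneg h.nonneg_left h.sigma_pos.le)).trans_eq ?_)
  rw [mul_assoc, mul_inv_cancel₀ h.sigma_pos.ne', mul_one]

theorem IsSpectralModel.vecNorm_factor_row_le (h : IsSpectralModel U S V σ c d) (hs : s ≤ σ)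
    {D : Tensor3 m r p} {x} (he : vecNorm (bcirc D x) ≤ c * s) :
    vecNorm ((bcirc U + bcirc D * (bcirc S)⁻¹) x) ≤ 2 * c := by
  refine (vecNorm_add_le (bcirc U x) ((bcirc D * (bcirc S)⁻¹) x)).trans ?_
  have := h.row_left x
  have := h.vecNorm_row_le hs he
  linarith

theorem IsSpectralModel.inv_mul_cancel (h : IsSpectralModel U S V σ c d)
    {ι : Type*} (A : Matrix ι (ZMod p × Fin r) ℝ) : A * (bcirc S)⁻¹ * bcirc S = A := by
  rw [Matrix.mul_assoc, nonsing_inv_mul _ ((isUnit_iff_isUnit_det _).1 h.isUnit), Matrix.mul_one]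

theorem IsSpectralModel.bcirc_factor_eq (h : IsSpectralModel U S V σ c d)
    (hQP : bcirc Q * (bcirc P)ᵀ = 1) : bcirc L =
      (bcirc U + bcirc (leftError U S L Q) * (bcirc S)⁻¹) * bcirc (sqrtFDiag S) * (bcirc P)ᵀ := by
  rw [← h.pos.bcirc_mul_eq h.isUnit, Matrix.mul_assoc, hQP, Matrix.mul_one]

theorem IsSpectralModel.isUnit_gram (h : IsSpectralModel U S V σ c d)
    (hQP : bcirc Q * (bcirc P)ᵀ = 1) (he : frob (bcirc (leftError U S L Q)) ≤ 1 / 10 * σ) :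
    IsUnit ((bcirc L)ᵀ * bcirc L) := by
  have h1 := Matrix.isUnit_gram h.orth_left (h.norm_mul_inv_le he)
  have h2 := h.pos.isUnit_bcirc_sqrt h.isUnit
  have h3 : IsUnit (bcirc P) := isUnit_iff_exists_inv.2 ⟨_, mul_transpose_symm hQP⟩
  have h4 : IsUnit (bcirc P)ᵀ := isUnit_iff_exists_inv'.2 ⟨_, hQP⟩
  rw [h.bcirc_factor_eq (L := L) hQP]
  set Z := bcirc U + bcirc (leftError U S L Q) * (bcirc S)⁻¹
  have e : (Z * bcirc (sqrtFDiag S) * (bcirc P)ᵀ)ᵀ * (Z * bcirc (sqrtFDiag S) * (bcirc P)ᵀ) =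
      bcirc P * bcirc (sqrtFDiag S) * (Zᵀ * Z) * bcirc (sqrtFDiag S) * (bcirc P)ᵀ := by
    simp only [transpose_mul, Matrix.transpose_transpose, bcirc_sqrtFDiag_transpose,
      Matrix.mul_assoc]
  rw [e]
  exact (((h3.mul h2).mul h1).mul h2).mul h4

theorem IsNearAlignment.frob_left_le (g : IsNearAlignment U S V c d s L R Q P) (hs : 0 ≤ s) :
    frob (bcirc (leftError U S L Q)) ≤ 0.02 * s :=
  (sq_le_sq₀ (frob_nonneg _) (by linarith)).1
    (le_trans (le_add_of_nonneg_right (sq_nonneg _)) g.frob_le)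

theorem IsNearAlignment.norm_left_le (g : IsNearAlignment U S V c d s L R Q P)
    (h : IsSpectralModel U S V σ c d) (hs : 0 ≤ s) (hsσ : s ≤ σ) :
    ‖bcirc (leftError U S L Q) * (bcirc S)⁻¹‖ ≤ 1 / 50 := by
  refine h.norm_mul_inv_le ((g.frob_left_le hs).trans ?_)
  linarith

theorem IsNearAlignment.isUnit_gram_left (g : IsNearAlignment U S V c d s L R Q P)
    (h : IsSpectralModel U S V σ c d) (hs : 0 ≤ s) (hsσ : s ≤ σ) :
    IsUnit ((bcirc L)ᵀ * bcirc L) :=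
  h.isUnit_gram g.inv ((g.frob_left_le hs).trans (by linarith))

/-- The alignment cancels in `L Rᵀ`, leaving `(U + F_L) Σ (V + F_R)ᵀ - U Σ Vᵀ` with `F Σ = D`. -/
theorem IsSpectralModel.product_sub_eq (h : IsSpectralModel U S V σ c d)
    (hQP : bcirc Q * (bcirc P)ᵀ = 1) :
    bcirc L * (bcirc R)ᵀ - bcirc U * bcirc S * (bcirc V)ᵀ =
      bcirc (leftError U S L Q) * (bcirc V + bcirc (leftError V S R P) * (bcirc S)⁻¹)ᵀ +
        bcirc U * (bcirc (leftError V S R P))ᵀ := by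
  have h1 : bcirc L * (bcirc R)ᵀ = bcirc L * bcirc Q * (bcirc R * bcirc P)ᵀ := by
    rw [transpose_mul, Matrix.mul_assoc (bcirc L), ← Matrix.mul_assoc (bcirc Q), hQP,
      Matrix.one_mul]
  have h2 := h.inv_mul_cancel (bcirc (leftError U S L Q))
  have h3 := h.inv_mul_cancel (bcirc (leftError V S R P))
  rw [h1, h.pos.bcirc_mul_eq h.isUnit U, h.pos.bcirc_mul_eq h.isUnit V]
  set FL := bcirc (leftError U S L Q) * (bcirc S)⁻¹
  set FR := bcirc (leftError V S R P) * (bcirc S)⁻¹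
  rw [← h2, ← h3, transpose_mul (bcirc V + FR), bcirc_sqrtFDiag_transpose,
    Matrix.mul_assoc (bcirc U + FL), ← Matrix.mul_assoc (bcirc (sqrtFDiag S)),
    h.pos.bcirc_sqrtFDiag_mul, transpose_mul, h.pos.bcirc_transpose_eq]
  simp only [transpose_add, Matrix.add_mul, Matrix.mul_add, Matrix.mul_assoc]
  abel

/-- Each entry is a sum of two inner products of rows, at most `(c s)(2d) + c (d s)`. This explains
the `3` in the thresholds. -/
theorem IsNearAlignment.abs_product_sub_le (g : IsNearAlignment U S V c d s L R Q P)
    (h : IsSpectralModel U S V σ c d) (hs : 0 ≤ s) (hsσ : s ≤ σ) (x y) :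
    |(bcirc L * (bcirc R)ᵀ - bcirc U * bcirc S * (bcirc V)ᵀ) x y| ≤ 3 * (c * d * s) := by
  rw [h.product_sub_eq g.inv]
  have h1 := abs_dotProduct_le (bcirc (leftError U S L Q) x)
    ((bcirc V + bcirc (leftError V S R P) * (bcirc S)⁻¹) y)
  have h2 := abs_dotProduct_le (bcirc U x) (bcirc (leftError V S R P) y)
  have h3 := h.symm.vecNorm_factor_row_le hsσ (g.row_right y)
  have h4 := mul_le_mul (g.row_left x) h3 (vecNorm_nonneg _) (mul_nonneg h.nonneg_left hs)
  have h5 := mul_le_mul (h.row_left x) (g.row_right y) (vecNorm_nonneg _) h.nonneg_left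
  refine (abs_add_le (bcirc (leftError U S L Q) x ⬝ᵥ
    ((bcirc V + bcirc (leftError V S R P) * (bcirc S)⁻¹) y))
    (bcirc U x ⬝ᵥ bcirc (leftError V S R P) y)).trans ?_
  linarith

/-- The error of the left factor after one scaled gradient step. -/
theorem IsSpectralModel.exists_leftError_step (h : IsSpectralModel U S V σ c d)
    (hQP : bcirc Q * (bcirc P)ᵀ = 1) (hR : IsUnit ((bcirc R)ᵀ * bcirc R)) (η : ℝ)
    {N E : Tensor3 m n p}
    (hN : bcirc N = bcirc L * (bcirc R)ᵀ - bcirc U * bcirc S * (bcirc V)ᵀ + bcirc E) :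
    ∃ C, (bcirc V + bcirc (leftError V S R P) * (bcirc S)⁻¹)ᵀ *
        (bcirc V + bcirc (leftError V S R P) * (bcirc S)⁻¹) * C = 1 ∧
      bcirc (leftError U S (L - η • (N ∗ₜ R ∗ₜ Tensor3.inv (transpose R ∗ₜ R))) Q) =
        (1 - η) • bcirc (leftError U S L Q) -
          η • (bcirc U * ((bcirc (leftError V S R P))ᵀ *
            ((bcirc V + bcirc (leftError V S R P) * (bcirc S)⁻¹) * C))) -
          η • (bcirc E * ((bcirc V + bcirc (leftError V S R P) * (bcirc S)⁻¹) * C)) := by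
  rw [h.product_sub_eq hQP] at hN
  have hRf := h.symm.bcirc_factor_eq (L := R) (mul_transpose_symm hQP)
  set W := bcirc V + bcirc (leftError V S R P) * (bcirc S)⁻¹
  set DR := bcirc (leftError V S R P)
  have hinv : (bcirc R)ᵀ * bcirc R * bcirc (Tensor3.inv (transpose R ∗ₜ R)) = 1 := by
    have h1 : IsInvertible (transpose R ∗ₜ R) :=
      isInvertible_of_isUnit (by rwa [bcirc_tprod, bcirc_transpose])
    have h2 := bcirc_mul_bcirc_inv h1
    rwa [bcirc_tprod, bcirc_transpose] at h2
  set B := bcirc (Tensor3.inv (transpose R ∗ₜ R))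
  have hHt := bcirc_sqrtFDiag_transpose S
  set H := bcirc (sqrtFDiag S)
  -- Conjugating the inverse Gram matrix of `R` by the alignment and Σ⋆^{1/2} gives the inverse Gram
  -- matrix of `W = V + F_R`; the step no longer depends on the choice of factorization.
  have hC : Wᵀ * W * (H * (bcirc Q)ᵀ * B * bcirc Q * H) = 1 := by
    rw [hRf] at hinv
    have e : (W * H * (bcirc Q)ᵀ)ᵀ * (W * H * (bcirc Q)ᵀ) * B =
        (bcirc Q * H) * (Wᵀ * W * (H * (bcirc Q)ᵀ * B)) := by
      simp only [transpose_mul, Matrix.transpose_transpose, hHt, Matrix.mul_assoc]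
    rw [e] at hinv
    have := mul_eq_one_comm.1 hinv
    simpa only [Matrix.mul_assoc] using this
  refine ⟨_, hC, ?_⟩
  set C := H * (bcirc Q)ᵀ * B * bcirc Q * H with hCdef
  have hRC : bcirc R * B * bcirc Q * H = W * C := by
    rw [hRf, hCdef]
    simp only [Matrix.mul_assoc]
  -- `Wᵀ W C = 1` returns the left error itself, which produces the factor `1 - η`.
  have h1 : bcirc N * (W * C) =
      bcirc (leftError U S L Q) + bcirc U * (DRᵀ * (W * C)) + bcirc E * (W * C) := by
    rw [hN, Matrix.add_mul, Matrix.add_mul, Matrix.mul_assoc _ Wᵀ, ← Matrix.mul_assoc Wᵀ, hC,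
      Matrix.mul_one, Matrix.mul_assoc (bcirc U)]
  have h2 : bcirc (leftError U S (L - η • (N ∗ₜ R ∗ₜ Tensor3.inv (transpose R ∗ₜ R))) Q) =
      bcirc (leftError U S L Q) - η • (bcirc N * (W * C)) := by
    rw [h.pos.bcirc_leftError, h.pos.bcirc_leftError, bcirc_sub, bcirc_smul, bcirc_tprod,
      bcirc_tprod, ← hRC]
    simp only [Matrix.sub_mul, Matrix.smul_mul, Matrix.mul_assoc]
    abel
  rw [h2, h1, sub_smul, one_smul, smul_add, smul_add]
  abel

/-- The gradient step keeps the factors close to the truth for the old alignment. -/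
theorem IsNearAlignment.step (g : IsNearAlignment U S V c d s L R Q P)
    (h : IsSpectralModel U S V σ c d) (hs : 0 ≤ s) (hsσ : s ≤ σ) {η : ℝ}
    (hη : η ∈ Set.Icc (1 / 4 : ℝ) (2 / 3))
    (hopt : (bcirc U + bcirc (leftError U S L Q) * (bcirc S)⁻¹)ᵀ * bcirc (leftError U S L Q) =
      (bcirc (leftError V S R P))ᵀ * (bcirc V + bcirc (leftError V S R P) * (bcirc S)⁻¹))
    {N E : Tensor3 m n p}
    (hN : bcirc N = bcirc L * (bcirc R)ᵀ - bcirc U * bcirc S * (bcirc V)ᵀ + bcirc E)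
    {a b : ℝ} (ha : 0 ≤ a) (hb : 0 ≤ b)
    (hrow : ∀ x, ∑ y, |bcirc E x y| ≤ a) (hcol : ∀ y, ∑ x, |bcirc E x y| ≤ b)
    (hab : a * b * (p * r) ≤ 42 / 10 ^ 8 * s ^ 2)
    (had : a * (2 * d * (21 / 20)) ≤ 14 / 10000 * (c * s))
    (hbc : b * (2 * c * (21 / 20)) ≤ 14 / 10000 * (d * s)) :
    let L' := L - η • (N ∗ₜ R ∗ₜ Tensor3.inv (transpose R ∗ₜ R))
    let R' := R - η • (transpose N ∗ₜ L ∗ₜ Tensor3.inv (transpose L ∗ₜ L))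
    (frob (bcirc (leftError U S L' Q)) ^ 2 + frob (bcirc (leftError V S R' P)) ^ 2 ≤
      (0.02 * (1 - 0.6 * η) * s) ^ 2) ∧
    (∀ x, vecNorm (bcirc (leftError U S L' Q) x) ≤ (1 - 0.97 * η) * (c * s)) ∧
    (∀ x, vecNorm (bcirc (leftError V S R' P) x) ≤ (1 - 0.97 * η) * (d * s)) := by
  intro L' R'
  have hN' : bcirc (transpose N) = bcirc R * (bcirc L)ᵀ - bcirc V * bcirc S * (bcirc U)ᵀ +
      bcirc (transpose E) := by
    rw [bcirc_transpose, hN, bcirc_transpose]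
    simp only [transpose_add, transpose_sub, transpose_mul, Matrix.transpose_transpose,
      h.pos.bcirc_transpose_eq, Matrix.mul_assoc]
  obtain ⟨C, hC, hL'⟩ := h.exists_leftError_step g.inv (g.symm.isUnit_gram_left h.symm hs hsσ) η hN
  obtain ⟨B, hB, hR'⟩ := h.symm.exists_leftError_step g.symm.inv (g.isUnit_gram_left h hs hsσ) η hN'
  have hFL := g.norm_left_le h hs hsσ
  have hFR := g.symm.norm_left_le h.symm hs hsσ
  -- Schur's test with `‖T‖_F² ≤ 1.071² p r`; the constants fit since `42 · 1.071² < 49`.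
  have hfE : ∀ {ι κ : Type} [Fintype ι] [Fintype κ] [DecidableEq ι] [DecidableEq κ]
      (E : Matrix ι κ ℝ) (T : Matrix κ (ZMod p × Fin r) ℝ) (a b : ℝ), 0 ≤ a → 0 ≤ b →
      (∀ x, ∑ y, |E x y| ≤ a) → (∀ y, ∑ x, |E x y| ≤ b) →
      a * b * (p * r) ≤ 42 / 10 ^ 8 * s ^ 2 → ‖T‖ ≤ 1071 / 1000 →
      frob (E * T) ≤ 7 / 10000 * s := by
    intro ι κ _ _ _ _ E T a b ha hb hrow hcol hab hT
    have h1 := frob_mul_le_of_sum_le E T ha hrow hcol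
    have h2 : frob T ^ 2 ≤ (1071 / 1000) ^ 2 * (p * r) := by
      have e1 := frob_mul_le_left T (1 : Matrix (ZMod p × Fin r) (ZMod p × Fin r) ℝ)
      rw [Matrix.mul_one, frob_one] at e1
      have e2 : frob T ≤ 1071 / 1000 * √(p * r) := e1.trans (by
        rw [Fintype.card_prod, ZMod.card, Fintype.card_fin, Nat.cast_mul]
        exact mul_le_mul_of_nonneg_right hT (Real.sqrt_nonneg _))
      have e3 := pow_le_pow_left₀ (frob_nonneg T) e2 2
      rwa [mul_pow, Real.sq_sqrt (by positivity)] at e3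
    rw [← sq_le_sq₀ (frob_nonneg _) (by positivity)]
    have h3 := mul_le_mul_of_nonneg_left h2 (mul_nonneg ha hb)
    nlinarith [sq_nonneg s]
  have hrow' : ∀ y, ∑ x, |bcirc (transpose E) y x| ≤ b := by
    rw [bcirc_transpose]
    exact hcol
  have hcol' : ∀ x, ∑ y, |bcirc (transpose E) y x| ≤ a := by
    rw [bcirc_transpose]
    exact hrow
  have hab' : b * a * (p * r) ≤ 42 / 10 ^ 8 * s ^ 2 := by rwa [mul_comm b a]
  refine ⟨?_, fun x => ?_, fun x => ?_⟩
  · rw [hL', hR']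
    refine frob_scaled_step_le hη hs h.orth_left h.orth_right hFL hFR hopt
      (norm_mul_gram_inv_sub_le h.orth_left hFL hB) (norm_mul_gram_inv_sub_le h.orth_right hFR hC)
      ?_ ?_ g.frob_le
    · exact hfE _ _ a b ha hb hrow hcol hab (norm_mul_gram_inv_le h.orth_right hFR hC)
    · exact hfE _ _ b a hb ha hrow' hcol' hab' (norm_mul_gram_inv_le h.orth_left hFL hB)
  · rw [hL']
    refine vecNorm_scaled_step_le hη h.nonneg_left x (h.row_left x) (g.row_left x)
      (g.symm.frob_left_le hs) (norm_mul_gram_inv_le h.orth_right hFR hC) (le_trans ?_ had)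
    refine vecNorm_mul_row_le _ _ x (by have := h.nonneg_right; positivity) (hrow x) fun y => ?_
    rw [mul_row]
    exact (vecNorm_vecMul_le _ _).trans (mul_le_mul (h.symm.vecNorm_factor_row_le hsσ
      (g.row_right y)) (norm_gram_inv_le h.orth_right hFR hC) (norm_nonneg _)
      (by have := h.nonneg_right; positivity))
  · rw [hR']
    refine vecNorm_scaled_step_le hη h.nonneg_right x (h.row_right x) (g.row_right x)
      (g.frob_left_le hs) (norm_mul_gram_inv_le h.orth_left hFL hB) (le_trans ?_ hbc)
    refine vecNorm_mul_row_le _ _ x (by have := h.nonneg_left; positivity) (hrow' x) fun y => ?_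
    rw [mul_row]
    exact (vecNorm_vecMul_le _ _).trans (mul_le_mul (h.vecNorm_factor_row_le hsσ
      (g.row_left y)) (norm_gram_inv_le h.orth_left hFL hB) (norm_nonneg _)
      (by have := h.nonneg_left; positivity))

/-- Two radii appear because, after a step, the Frobenius errors are already at the new radius `s`
while the rows only need the old one `t` to be bounded by `2c`. -/
theorem IsSpectralModel.vecNorm_realign_le (h : IsSpectralModel U S V σ c d)
    (hQP : bcirc Q * (bcirc P)ᵀ = 1) (hsσ : s ≤ σ)
    (h₁ : frob (bcirc (leftError U S L Q)) ≤ 0.02 * s) {Q' : Tensor3 r r p}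
    (h₂ : frob (bcirc (leftError U S L Q')) ≤ 0.02 * s) {x} {t : ℝ} (ht : t ≤ σ)
    (hx : vecNorm (bcirc (leftError U S L Q) x) ≤ c * t) :
    vecNorm (bcirc (leftError U S L Q') x) ≤
      vecNorm (bcirc (leftError U S L Q) x) + 0.0818 * (c * s) := by
  have hH := (isUnit_iff_isUnit_det _).1 (h.pos.isUnit_bcirc_sqrt h.isUnit)
  have hF : ‖bcirc (leftError U S L Q) * (bcirc S)⁻¹‖ ≤ 1 / 50 :=
    h.norm_mul_inv_le (h₁.trans (by linarith))
  have hrow := h.vecNorm_factor_row_le ht hx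
  have hL := h.bcirc_factor_eq (L := L) hQP
  have hD := h.inv_mul_cancel (bcirc (leftError U S L Q))
  have hQ' : bcirc (leftError U S L Q') =
      ((bcirc U + bcirc (leftError U S L Q) * (bcirc S)⁻¹) *
        (bcirc (sqrtFDiag S) * (bcirc P)ᵀ * bcirc Q' * (bcirc (sqrtFDiag S))⁻¹) - bcirc U) *
          bcirc S := by
    rw [h.pos.bcirc_leftError U L Q', Matrix.sub_mul, hL]
    congr 1
    rw [← h.pos.bcirc_sqrtFDiag_mul]
    simp only [Matrix.mul_assoc]
    rw [← Matrix.mul_assoc (bcirc (sqrtFDiag S))⁻¹, nonsing_inv_mul _ hH, Matrix.one_mul]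
  have := Matrix.vecNorm_realign_le (G := bcirc S)
    (K := bcirc (sqrtFDiag S) * (bcirc P)ᵀ * bcirc Q' * (bcirc (sqrtFDiag S))⁻¹)
    h.nonneg_left h.orth_left hF x hrow (s := s) (by rwa [hD]) (by rwa [← hQ'])
  rwa [← hQ', hD] at this

end LocalStep

end Tensor3

end

noncomputable section

namespace Tensor3

open Matrix

/-! ### The inductive step and its constants. -/

section Convergence

variable {m n p r : ℕ} [NeZero p] {U L : Tensor3 m r p} {V R : Tensor3 n r p}
  {S Q : Tensor3 r r p} {σ c d s : ℝ}

/-- The tolerance `1/10`, looser than `0.02`, admits alignments that are not yet known to be optimal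
and still makes both Gram matrices invertible. -/
theorem IsSpectralModel.exists_isOptimalAlignment (h : IsSpectralModel U S V σ c d)
    (hQ : IsInvertible Q) (ha : alignError U S V L R Q ≤ 1 / 10 * σ / √p) :
    ∃ Q', IsOptimalAlignment U S V L R Q' := by
  have hσ := h.sigma_pos
  rw [alignError_le_iff (by positivity)] at ha
  have hQP : bcirc Q * (bcirc (transpose (inv Q)))ᵀ = 1 := by
    rw [← bcirc_transpose, transpose_transpose, bcirc_mul_bcirc_inv hQ]
  refine Tensor3.exists_isOptimalAlignment (h.isUnit_gram hQP ?_)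
    (h.symm.isUnit_gram (mul_transpose_symm hQP) ?_) (h.pos.isUnit_bcirc_sqrt h.isUnit)
  · exact (sq_le_sq₀ (frob_nonneg _) (by positivity)).1
      (le_trans (le_add_of_nonneg_right (sq_nonneg _)) ha)
  · exact (sq_le_sq₀ (frob_nonneg _) (by positivity)).1
      (le_trans (le_add_of_nonneg_left (sq_nonneg _)) ha)

theorem IsOptimalAlignment.bcirc_mul_transpose (h : IsOptimalAlignment U S V L R Q) :
    bcirc Q * (bcirc (transpose (inv Q)))ᵀ = 1 := by
  rw [← bcirc_transpose, transpose_transpose, bcirc_mul_bcirc_inv h.1]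

/-- One step of the iteration preserves near optimal alignment, at a linear rate. -/
theorem IsOptimalAlignment.step (h : IsSpectralModel U S V σ c d)
    (hQ : IsOptimalAlignment U S V L R Q)
    (g : IsNearAlignment U S V c d s L R Q (transpose (inv Q)))
    (hs : 0 ≤ s) (hsσ : s ≤ σ) {η : ℝ} (hη : η ∈ Set.Icc (1 / 4 : ℝ) (2 / 3))
    {N E : Tensor3 m n p}
    (hN : bcirc N = bcirc L * (bcirc R)ᵀ - bcirc U * bcirc S * (bcirc V)ᵀ + bcirc E)
    {a b : ℝ} (ha : 0 ≤ a) (hb : 0 ≤ b)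
    (hrow : ∀ x, ∑ y, |bcirc E x y| ≤ a) (hcol : ∀ y, ∑ x, |bcirc E x y| ≤ b)
    (hab : a * b * (p * r) ≤ 42 / 10 ^ 8 * s ^ 2)
    (had : a * (2 * d * (21 / 20)) ≤ 14 / 10000 * (c * s))
    (hbc : b * (2 * c * (21 / 20)) ≤ 14 / 10000 * (d * s)) {L' : Tensor3 m r p}
    {R' : Tensor3 n r p} (hL' : L' = L - η • (N ∗ₜ R ∗ₜ inv (transpose R ∗ₜ R)))
    (hR' : R' = R - η • (transpose N ∗ₜ L ∗ₜ inv (transpose L ∗ₜ L))) :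
    (∃ Q', IsOptimalAlignment U S V L' R' Q') ∧
    ∀ Q', IsOptimalAlignment U S V L' R' Q' →
      IsNearAlignment U S V c d ((1 - 0.6 * η) * s) L' R' Q' (transpose (inv Q')) := by
  obtain ⟨h1, h2, h3⟩ := g.step h hs hsσ hη (hQ.transpose_mul_eq h.pos h.isUnit) hN ha hb hrow
    hcol hab had hbc
  rw [← hL', ← hR'] at h1
  rw [← hL'] at h2
  rw [← hR'] at h3
  have hτ : 0 ≤ 1 - 0.6 * η := by linarith [hη.2]
  have hτ1 : 1 - 0.6 * η ≤ 1 := by linarith [hη.1]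
  have hs' : 0 ≤ (1 - 0.6 * η) * s := mul_nonneg hτ hs
  have hs'σ : (1 - 0.6 * η) * s ≤ σ := (mul_le_of_le_one_left hs hτ1).trans hsσ
  rw [mul_assoc] at h1
  -- The old alignment `Q` is a competitor for the new factors: it gives existence of an optimal one
  -- and bounds its error.
  have hal : alignError U S V L' R' Q ≤ 0.02 * ((1 - 0.6 * η) * s) / √p :=
    (alignError_le_iff (by positivity)).2 h1
  refine ⟨h.exists_isOptimalAlignment hQ.1 (hal.trans ?_), fun Q' hQ' => ?_⟩
  · gcongr
    linarith
  have h1' := (alignError_le_iff (by positivity)).1 ((hQ'.2 Q hQ.1).trans hal)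
  -- What is needed is `1 - 0.97η + 0.0818 (1 - 0.6η) ≤ 1 - 0.6η`, which holds for `η ≥ 1/4`.
  have hrows : ∀ {e x y : ℝ}, 0 ≤ e → x ≤ (1 - 0.97 * η) * (e * s) →
      y ≤ x + 0.0818 * (e * ((1 - 0.6 * η) * s)) → y ≤ e * ((1 - 0.6 * η) * s) := by
    intro e x y he hx hy
    have hes : 0 ≤ e * s := mul_nonneg he hs
    nlinarith [mul_nonneg hes (by linarith [hη.1] : 0 ≤ η - 1 / 4)]
  have hweak : ∀ {e x : ℝ}, 0 ≤ e → x ≤ (1 - 0.97 * η) * (e * s) → x ≤ e * s := by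
    intro e x he hx
    exact hx.trans (mul_le_of_le_one_left (mul_nonneg he hs) (by linarith [hη.1]))
  have hleft : ∀ {x y : ℝ}, x ^ 2 + y ^ 2 ≤ (0.02 * ((1 - 0.6 * η) * s)) ^ 2 → 0 ≤ x → 0 ≤ y →
      x ≤ 0.02 * ((1 - 0.6 * η) * s) ∧ y ≤ 0.02 * ((1 - 0.6 * η) * s) := by
    intro x y hxy hx hy
    exact ⟨(sq_le_sq₀ hx (by positivity)).1 (by linarith [sq_nonneg y]),
      (sq_le_sq₀ hy (by positivity)).1 (by linarith [sq_nonneg x])⟩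
  have e1 := hleft h1 (frob_nonneg _) (frob_nonneg _)
  have e2 := hleft h1' (frob_nonneg _) (frob_nonneg _)
  refine ⟨hQ'.bcirc_mul_transpose, h1', fun x => ?_, fun x => ?_⟩
  · exact hrows h.nonneg_left (h2 x) (h.vecNorm_realign_le g.inv hs'σ e1.1 e2.1 hsσ
      (hweak h.nonneg_left (h2 x)))
  · exact hrows h.nonneg_right (h3 x) (h.symm.vecNorm_realign_le g.symm.inv hs'σ e1.2 e2.2 hsσ
      (hweak h.nonneg_right (h3 x)))

theorem IsSkinnyTSVD.isSpectralModel {X : Tensor3 m n p} {μ : ℝ} (h : IsSkinnyTSVD X U S V)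
    (hrank : ∀ k, multiRank X k = r) (hr : 0 < r) (hinc : IsIncoherent μ U V) :
    IsSpectralModel U S V (sigmaMin X) (√(μ * r / m)) (√(μ * r / n)) where
  pos := h.isPosFDiagonal
  isUnit := h.isPosFDiagonal.isUnit_bcirc (h.sigmaMin_pos hrank hr) (h.sigmaMin_le hrank)
  sigma_pos := h.sigmaMin_pos hrank hr
  norm_inv := h.isPosFDiagonal.norm_inv_le (h.sigmaMin_pos hrank hr) (h.sigmaMin_le hrank)
  orth_left := by rw [← bcirc_transpose, ← bcirc_tprod, h.left_orth, bcirc_identity]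
  orth_right := by rw [← bcirc_transpose, ← bcirc_tprod, h.right_orth, bcirc_identity]
  nonneg_left := Real.sqrt_nonneg _
  nonneg_right := Real.sqrt_nonneg _
  row_left x := (vecNorm_bcirc_row_le U x).trans hinc.1
  row_right x := (vecNorm_bcirc_row_le V x).trans hinc.2

theorem IsSkinnyTSVD.bcirc_eq {X : Tensor3 m n p} (h : IsSkinnyTSVD X U S V) :
    bcirc X = bcirc U * bcirc S * (bcirc V)ᵀ := by
  rw [h.eq_prod, bcirc_tprod, bcirc_tprod, bcirc_transpose]

theorem IsSparse.nonneg {α : ℝ} {A : Tensor3 m n p} (h : IsSparse α A) (hm : 0 < m)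
    (hn : 0 < n) : 0 ≤ α := by
  have h1 := (Nat.cast_nonneg _).trans (h.1 ⟨0, hm⟩)
  have h2 : (0 : ℝ) < n * p := mul_pos (Nat.cast_pos.2 hn) (Nat.cast_pos.2 (NeZero.pos p))
  exact nonneg_of_mul_nonneg_left h1 h2

/-- The exponents `1.5` say that `αμRI₃ · √(RI₃) ≤ 10⁻⁴`. The square root is spent in the Frobenius
bound, where `‖P_R‖_F` is of order `√(RI₃)`; the row bounds do not need it. -/
theorem sparsity_bounds {α μ : ℝ} (hα0 : 0 ≤ α) (hμ : 1 ≤ μ) (hr : 0 < r)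
    (hα : α ≤ 1 / (10 ^ 4 * μ * (r : ℝ) ^ (1.5 : ℝ) * (p : ℝ) ^ (1.5 : ℝ))) :
    α * μ * r * p ≤ 1 / 10 ^ 4 ∧ (α * μ * r * p) ^ 2 * (r * p) ≤ 1 / 10 ^ 8 := by
  have hr1 : (1 : ℝ) ≤ r := Nat.one_le_cast.2 hr
  have hp1 : (1 : ℝ) ≤ p := Nat.one_le_cast.2 (NeZero.pos p)
  have hpow : ∀ x : ℝ, 1 ≤ x → x ^ (1.5 : ℝ) = x * √x := fun x hx => by
    rw [Real.sqrt_eq_rpow, ← Real.rpow_one_add' (by linarith) (by norm_num)]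
    norm_num
  rw [hpow _ hr1, hpow _ hp1, le_div_iff₀ (by positivity)] at hα
  have h1 : α * μ * r * p * √(r * p) ≤ 1 / 10 ^ 4 := by
    rw [Real.sqrt_mul (by positivity)]
    linarith
  have h2 : 1 ≤ √((r : ℝ) * p) := Real.one_le_sqrt.2 (by nlinarith)
  have h3 : 0 ≤ α * μ * r * p := by positivity
  refine ⟨(le_mul_of_one_le_right h3 h2).trans h1, ?_⟩
  have h4 := pow_le_pow_left₀ (by positivity) h1 2
  rw [mul_pow, Real.sq_sqrt (by positivity)] at h4
  exact h4.trans_eq (by norm_num)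

end Convergence

end Tensor3

end

/-! ### The convergence theorem, by induction on the iterations. -/

theorem theorem2 {I₁ I₂ I₃ R : ℕ} [NeZero I₃] (hR : 0 < R)
    (Xs Ss : Tensor3 I₁ I₂ I₃)
    (Us : Tensor3 I₁ R I₃) (Gs : Tensor3 R R I₃) (Vs : Tensor3 I₂ R I₃)
    (hrank : tubalRank Xs = R) (hfull : ∀ k, multiRank Xs k = tubalRank Xs)
    (hsvd : IsSkinnyTSVD Xs Us Gs Vs)
    (μ : ℝ) (hμ : 1 ≤ μ) (hinc : IsIncoherent μ Us Vs)
    (α : ℝ) (hα : α ≤ 1 / (10 ^ 4 * μ * (R : ℝ) ^ (1.5 : ℝ) * (I₃ : ℝ) ^ (1.5 : ℝ)))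
    (hsparse : IsSparse α Ss)
    (η : ℝ) (hη : η ∈ Set.Icc (1 / 4 : ℝ) (2 / 3))
    (τ : ℝ) (hτ : τ = 1 - 0.6 * η)
    (ζ : ℕ → ℝ) (hζ₁ : ζ 1 = 3 / √((I₁ : ℝ) * I₂) * μ * R * sigmaMin Xs)
    (hζ : ∀ k, 1 ≤ k → ζ (k + 1) = τ * ζ k)
    (S : ℕ → Tensor3 I₁ I₂ I₃) (Lf : ℕ → Tensor3 I₁ R I₃) (Rf : ℕ → Tensor3 I₂ R I₃)
    (halg : IsRTPCASGD (Xs + Ss) η ζ S Lf Rf)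
    -- `Q k` is any optimal alignment tensor, provided that there is one
    (Q : ℕ → Tensor3 R R I₃)
    (hQ : ∀ k, (∃ P, IsOptimalAlignment Us Gs Vs (Lf k) (Rf k) P) →
      IsOptimalAlignment Us Gs Vs (Lf k) (Rf k) (Q k))
    (hdist₀ : factorDist Us Gs Vs (Lf 0) (Rf 0) ≤ 0.02 / √(I₃ : ℝ) * sigmaMin Xs)
    (hinc₀ : incoherenceError Us Gs Vs (Lf 0) (Rf 0) (Q 0) ≤ √(μ * R) * sigmaMin Xs) :
    ∀ k : ℕ,
      -- the iteration and the alignment tensors are well defined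
      IsInvertible (transpose (Lf k) ∗ₜ Lf k) ∧
      IsInvertible (transpose (Rf k) ∗ₜ Rf k) ∧
      IsOptimalAlignment Us Gs Vs (Lf k) (Rf k) (Q k) ∧
      -- linear convergence
      factorDist Us Gs Vs (Lf k) (Rf k) ≤ 0.02 / √(I₃ : ℝ) * τ ^ k * sigmaMin Xs ∧
      incoherenceError Us Gs Vs (Lf k) (Rf k) (Q k) ≤ √(μ * R) * τ ^ k * sigmaMin Xs ∧
      infNorm (Xs - Lf k ∗ₜ transpose (Rf k)) ≤
        3 / √((I₁ : ℝ) * I₂) * μ * R * τ ^ k * sigmaMin Xs := by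
  have hr : ∀ k, multiRank Xs k = R := fun k => (hfull k).trans hrank
  have hI₁ : 0 < I₁ := hR.trans_le ((hr 0).symm.le.trans
    ((Matrix.rank_le_card_height _).trans_eq (Fintype.card_fin _)))
  have hI₂ : 0 < I₂ := hR.trans_le ((hr 0).symm.le.trans
    ((Matrix.rank_le_card_width _).trans_eq (Fintype.card_fin _)))
  have hI₁' : (0 : ℝ) < I₁ := Nat.cast_pos.2 hI₁
  have hI₂' : (0 : ℝ) < I₂ := Nat.cast_pos.2 hI₂
  have hR' : (0 : ℝ) < R := Nat.cast_pos.2 hR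
  have hp' : (0 : ℝ) < I₃ := Nat.cast_pos.2 (NeZero.pos I₃)
  have hμ0 : 0 < μ := zero_lt_one.trans_le hμ
  have hmodel := hsvd.isSpectralModel hr hR hinc
  have hα0 := hsparse.nonneg hI₁ hI₂
  obtain ⟨hα1, hα2⟩ := sparsity_bounds hα0 hμ hR hα
  have hX := hsvd.bcirc_eq
  set σ := sigmaMin Xs
  have hσ : 0 < σ := hmodel.sigma_pos
  set c := √(μ * R / I₁) with hc
  set d := √(μ * R / I₂) with hd
  have hc0 : 0 < c := Real.sqrt_pos.2 (by positivity)
  have hd0 : 0 < d := Real.sqrt_pos.2 (by positivity)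
  have hc2 : c ^ 2 * I₁ = μ * R := by
    rw [hc, Real.sq_sqrt (by positivity)]
    field_simp
  have hd2 : d ^ 2 * I₂ = μ * R := by
    rw [hd, Real.sq_sqrt (by positivity)]
    field_simp
  have hcI : √(I₁ : ℝ) * c = √(μ * R) := by
    rw [hc, ← Real.sqrt_mul hI₁'.le]
    congr 1
    field_simp
  have hdI : √(I₂ : ℝ) * d = √(μ * R) := by
    rw [hd, ← Real.sqrt_mul hI₂'.le]
    congr 1
    field_simp
  have hcd : 3 / √((I₁ : ℝ) * I₂) * μ * R = 3 * (c * d) := by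
    have h1 : √((I₁ : ℝ) * I₂) * (c * d) = μ * R := by
      rw [Real.sqrt_mul hI₁'.le, mul_mul_mul_comm, hcI, hdI, Real.mul_self_sqrt (by positivity)]
    have h2 : 0 < √((I₁ : ℝ) * I₂) := Real.sqrt_pos.2 (by positivity)
    rw [mul_assoc, ← h1]
    field_simp
  have hτ0 : 0 ≤ τ := by linarith [hη.2]
  have hτ1 : τ ≤ 1 := by linarith [hη.1]
  have hs0 : ∀ k, 0 ≤ τ ^ k * σ := fun k => by positivity
  have hsσ : ∀ k, τ ^ k * σ ≤ σ := fun k => mul_le_of_le_one_left hσ.le (pow_le_one₀ hτ0 hτ1)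
  -- The threshold applied to the residual of iterate `k` is exactly the entrywise error bound for
  -- that iterate.
  have hζk : ∀ k, ζ (k + 1) = 3 * (c * d * (τ ^ k * σ)) := by
    intro k
    induction k with
    | zero =>
      rw [zero_add, hζ₁, hcd]
      ring
    | succ k ih =>
      rw [hζ (k + 1) (by omega), ih]
      ring
  have hinf : ∀ k, IsNearAlignment Us Gs Vs c d (τ ^ k * σ) (Lf k) (Rf k) (Q k)
      (transpose (inv (Q k))) →
      infNorm (Xs - Lf k ∗ₜ transpose (Rf k)) ≤ 3 * (c * d * (τ ^ k * σ)) := by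
    intro k g
    refine infNorm_le (by have := hs0 k; positivity) fun x y => ?_
    rw [bcirc_sub, hX, bcirc_tprod, bcirc_transpose, Matrix.sub_apply, abs_sub_comm,
      ← Matrix.sub_apply]
    exact g.abs_product_sub_le hmodel (hs0 k) (hsσ k) x y
  have hind : ∀ k, IsOptimalAlignment Us Gs Vs (Lf k) (Rf k) (Q k) ∧
      IsNearAlignment Us Gs Vs c d (τ ^ k * σ) (Lf k) (Rf k) (Q k) (transpose (inv (Q k))) := by
    intro k
    induction k with
    | zero =>
      -- The hypothesis bounds an infimum not yet known to be attained. A nearly minimizing tensor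
      -- gives existence, and only then is `Q 0` known to be optimal.
      obtain ⟨Q₀, hQ₀, hQ₀'⟩ := exists_alignError_lt (c := 1 / 10 * σ / √(I₃ : ℝ))
        (hdist₀.trans_lt (by
          rw [div_mul_eq_mul_div]
          gcongr
          norm_num))
      have hopt := hQ 0 (hmodel.exists_isOptimalAlignment hQ₀ hQ₀'.le)
      rw [hopt.factorDist_eq, div_mul_eq_mul_div] at hdist₀
      rw [pow_zero, one_mul]
      refine ⟨hopt, hopt.bcirc_mul_transpose, (alignError_le_iff (by positivity)).1 hdist₀,
        fun x => ?_, fun x => ?_⟩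
      · refine (vecNorm_bcirc_row_le _ x).trans ?_
        have h1 := (le_max_left _ _).trans hinc₀
        rw [← hcI, mul_assoc] at h1
        exact le_of_mul_le_mul_left h1 (Real.sqrt_pos.2 hI₁')
      · refine (vecNorm_bcirc_row_le _ x).trans ?_
        have h1 := (le_max_right _ _).trans hinc₀
        rw [← hdI, mul_assoc] at h1
        exact le_of_mul_le_mul_left h1 (Real.sqrt_pos.2 hI₂')
    | succ k ih =>
      obtain ⟨hopt, g⟩ := ih
      obtain ⟨hS, hL, hRf⟩ := halg k
      have hD : Xs + Ss - Lf k ∗ₜ transpose (Rf k) = Ss + (Xs - Lf k ∗ₜ transpose (Rf k)) := by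
        abel
      -- The thresholded matrix is the sparse truth plus the current low-rank error, which lies
      -- below the threshold by induction.
      have hE := softThreshold_sub_le (S := Ss) ((hinf k g).trans_eq (hζk k).symm)
      rw [← hD, ← hS, hζk] at hE
      have hs := hs0 k
      have hsk := hsσ k
      have hpow : τ ^ (k + 1) * σ = τ * (τ ^ k * σ) := by ring
      rw [hpow]
      generalize τ ^ k * σ = s at *
      have hc6 : 0 ≤ 2 * (3 * (c * d * s)) := by positivity
      have hN : bcirc (Lf k ∗ₜ transpose (Rf k) + S (k + 1) - (Xs + Ss)) =
          bcirc (Lf k) * (bcirc (Rf k)).transpose -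
            bcirc Us * bcirc Gs * (bcirc Vs).transpose + bcirc (S (k + 1) - Ss) := by
        rw [← hX, ← bcirc_transpose, ← bcirc_tprod, ← bcirc_sub, ← bcirc_add]
        congr 1
        abel
      obtain ⟨hex, hall⟩ := hopt.step hmodel g hs hsk hη hN (by positivity) (by positivity)
        (sum_row_le_of_isSparse hsparse hc6 hE) (sum_col_le_of_isSparse hsparse hc6 hE)
        (by
          -- `c² I₁ = d² I₂ = μR` removes the dimensions; `36 · 10⁻⁸ ≤ 42 · 10⁻⁸` here, and `12.6 ·
          -- 10⁻⁴ ≤ 14 · 10⁻⁴` in the next two goals.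
          have e : α * (I₂ * I₃) * (2 * (3 * (c * d * s))) *
              (α * (I₁ * I₃) * (2 * (3 * (c * d * s)))) * (I₃ * R) =
              36 * (α ^ 2 * I₃ ^ 2 * (c ^ 2 * I₁) * (d ^ 2 * I₂) * (R * I₃)) * s ^ 2 := by ring
          rw [e, hc2, hd2]
          refine mul_le_mul_of_nonneg_right ?_ (sq_nonneg s)
          linarith)
        (by
          have e : α * (I₂ * I₃) * (2 * (3 * (c * d * s))) * (2 * d * (21 / 20)) =
              12.6 * (α * I₃ * (d ^ 2 * I₂)) * (c * s) := by ring
          rw [e, hd2]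
          refine mul_le_mul_of_nonneg_right ?_ (by positivity)
          linarith)
        (by
          have e : α * (I₁ * I₃) * (2 * (3 * (c * d * s))) * (2 * c * (21 / 20)) =
              12.6 * (α * I₃ * (c ^ 2 * I₁)) * (d * s) := by ring
          rw [e, hc2]
          refine mul_le_mul_of_nonneg_right ?_ (by positivity)
          linarith) hL hRf
      have hopt' := hQ (k + 1) hex
      refine ⟨hopt', ?_⟩
      have := hall _ hopt'
      rwa [← hτ] at this
  intro k
  obtain ⟨hopt, g⟩ := hind k
  have hs := hs0 k
  refine ⟨isInvertible_of_isUnit ?_, isInvertible_of_isUnit ?_, hopt, ?_, ?_, ?_⟩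
  · rw [bcirc_tprod, bcirc_transpose]
    exact g.isUnit_gram_left hmodel hs (hsσ k)
  · rw [bcirc_tprod, bcirc_transpose]
    exact g.symm.isUnit_gram_left hmodel.symm hs (hsσ k)
  · rw [hopt.factorDist_eq, mul_assoc, div_mul_eq_mul_div]
    exact (alignError_le_iff (by positivity)).2 g.frob_le
  · rw [mul_assoc]
    refine max_le ?_ ?_
    · rw [← hcI, mul_assoc]
      exact mul_le_mul_of_nonneg_left (twoInfNorm_le (by positivity) g.row_left)
        (Real.sqrt_nonneg _)
    · rw [← hdI, mul_assoc]
      exact mul_le_mul_of_nonneg_left (twoInfNorm_le (by positivity) g.row_right)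
        (Real.sqrt_nonneg _)
  · rw [hcd]
    exact (hinf k g).trans_eq (by ring)
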